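/- **Theorem (uniform consistency of the boundary-corrected smoothed Grenander hazard estimator).** Let $(X_i,C_i)$, $i\ge 1$, be i.i.d. pairs, where the survival time $X_i\ge 0$ and the censoring time $C_i\ge 0$ are independent, with distribution functions $F,G$ and Lebesgue densities $f,g$. Only $T_i=\min(X_i,C_i)$ and $\Delta_i=\mathbf 1_{\{X_i\le C_i\}}$, $1\le i\le n$, are observed. Let $H$ be the distribution function of $T_i$, let $\tau_F,\tau_G,\tau_H$ be the right end points of the supports of $F,G,H$, and assume $\tau_H=\tau_G<\tau_F\le\infty$. Let $\lambda=f/(1-F)$ be the hazard rate, let $$\Lambda_n(t)=\sum_{i=1}^n\frac{\mathbf 1_{\{T_i\le t\}}\Delta_i}{\sum_{j=1}^n\mathbf 1_{\{T_j\ge T_i\}}}$$ be the Nelson–Aalen estimator, $\tilde\Lambda_n$ its greatest convex minorant on $[0,\tau_H]$, and $\tilde\lambda_n$ the left-hand slope of $\tilde\Lambda_n$. Let $k$ be a symmetric probability density that vanishes outside $[-1,1]$ and is differentiable on $(-1,1)$ with bounded derivative there. For $s\in[0,1]$ let $\phi(s),\psi(s)$ be the unique solution of $$\phi(s)\int_{-1}^s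 k(u)\,du+\psi(s)\int_{-1}^s uk(u)\,du=1,\qquad \phi(s)\int_{-1}^s uk(u)\,du+\psi(s)\int_{-1}^s u^2k(u)\,du=0.$$ For a bandwidth $b=b_n>0$ put $$k^{(x)}(u)=\begin{cases}\phi(\tfrac xb)k(u)+\psi(\tfrac xb)uk(u), & x\in[0,b],\\ k(u), & x\in(b,\tau_H-b),\\ \phi(\tfrac{\tau_H-x}b)k(u)-\psi(\tfrac{\tau_H-x}b)uk(u), & x\in[\tau_H-b,\tau_H],\end{cases}\qquad k^{(x)}_b(u)=\frac1b\,k^{(x)}\!\left(\frac ub\right),$$ (the first applicable case being used while $b$ is so large that the cases overlap) and define, for $x\in[0,\tau_H]$, $$\hat\lambda_n^{SG}(x)=\int_{(x-b)\vee 0}^{(x+b)\wedge\tau_H}k_b^{(x)}(x-u)\,\tilde\lambda_n(u)\,du.$$ Suppose that $\lambda$ is nondecreasing and uniformly continuous on $[0,\tau_H)$ and that $b_nn^{\alpha}\to c$ for some $c\in(0,\infty)$ and $0<\alpha<1/2$. Then, for every $0<M<\tau_H$, $$\sup_{x\in[0,M]}\bigl|\hat\lambda_n^{SG}(x)-\lambda(x)\bigr|\longrightarrow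 0\quad\text{in probability as } n\to\infty .$$ -/

import Mathlib

open Set Filter Topology MeasureTheory ProbabilityTheory

noncomputable section

namespace SmoothedGrenander

/-! ### The random censorship model -/

/-- The measure on the line with Lebesgue density `f`. -/
def densityLaw (f : ℝ → ℝ) : Measure ℝ :=
  volume.withDensity (fun t => ENNReal.ofReal (f t))

/-- The follow-up time `T i = min (X i) (C i)`. -/
def followUp {Ω : Type*} (X C : ℕ → Ω → ℝ) (i : ℕ) (ω : Ω) : ℝ :=
  min (X i ω) (C i ω)

open Classical in
/-- The censoring indicator `Δ i = 1_{X i ≤ C i}`. -/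
def censInd {Ω : Type*} (X C : ℕ → Ω → ℝ) (i : ℕ) (ω : Ω) : ℝ :=
  if X i ω ≤ C i ω then 1 else 0

/-- Random censorship: the pairs `(X i, C i)` are i.i.d., the survival time `X i` and the
censoring time `C i` are nonnegative and independent, with Lebesgue densities `f` and `g`. -/
structure IsCensoredSample {Ω : Type*} [MeasurableSpace Ω] (P : Measure Ω)
    (X C : ℕ → Ω → ℝ) (f g : ℝ → ℝ) : Prop where
  measurable_survival : ∀ i, Measurable (X i)
  measurable_censoring : ∀ i, Measurable (C i)
  measurable_f : Measurable f
  measurable_g : Measurable g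
  f_nonneg : ∀ t, 0 ≤ f t
  g_nonneg : ∀ t, 0 ≤ g t
  law_survival : ∀ i, P.map (X i) = densityLaw f
  law_censoring : ∀ i, P.map (C i) = densityLaw g
  survival_nonneg : ∀ i, ∀ᵐ ω ∂P, 0 ≤ X i ω
  censoring_nonneg : ∀ i, ∀ᵐ ω ∂P, 0 ≤ C i ω
  indep_survival_censoring : ∀ i, IndepFun (X i) (C i) P
  indep_pairs : iIndepFun (fun i ω => (X i ω, C i ω)) P

/-- The right end point `sup {t | F t < 1}` of the support of a probability measure on the line
with distribution function `F`. -/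
def upperEndpoint (μ : Measure ℝ) : EReal :=
  ⨆ t ∈ {t : ℝ | cdf μ t < 1}, (t : EReal)

/-- The hazard rate `λ = f / (1 - F)`, with `F` the distribution function of the density `f`. -/
def hazard (f : ℝ → ℝ) (t : ℝ) : ℝ :=
  f t / (1 - cdf (densityLaw f) t)

/-! ### The Grenander-type estimator -/

open Classical in
/-- The Nelson-Aalen estimator based on the first `n` observations. -/
def nelsonAalen {Ω : Type*} (X C : ℕ → Ω → ℝ) (n : ℕ) (ω : Ω) (t : ℝ) : ℝ :=
  ∑ i ∈ Finset.range n,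
    (if followUp X C i ω ≤ t then censInd X C i ω else 0) /
      ∑ j ∈ Finset.range n, (if followUp X C i ω ≤ followUp X C j ω then (1 : ℝ) else 0)

/-- The greatest convex minorant on `s` of `φ` (used for `φ` having some convex minorant on `s`):
the pointwise supremum of all convex functions on `s` lying below `φ`. -/
def greatestConvexMinorant (s : Set ℝ) (φ : ℝ → ℝ) (t : ℝ) : ℝ :=
  sSup {y : ℝ | ∃ h : ℝ → ℝ, ConvexOn ℝ s h ∧ (∀ u ∈ s, h u ≤ φ u) ∧ y = h t}

/-- The Grenander-type estimator: the left-hand slope of the greatest convex minorant, on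
`[0, τ]`, of the Nelson-Aalen estimator. -/
def grenander {Ω : Type*} (X C : ℕ → Ω → ℝ) (τ : ℝ) (n : ℕ) (ω : Ω) (u : ℝ) : ℝ :=
  derivWithin (greatestConvexMinorant (Icc 0 τ) (nelsonAalen X C n ω)) (Iio u) u

/-! ### Boundary kernels and the smoothed estimator -/

/-- A symmetric probability density supported in `[-1, 1]`. -/
structure IsStandardKernel (k : ℝ → ℝ) : Prop where
  nonneg : ∀ u, 0 ≤ k u
  even : ∀ u, k (-u) = k u
  integral_eq_one : ∫ u, k u = 1
  eq_zero : ∀ u, u ∉ Icc (-1 : ℝ) 1 → k u = 0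

/-- The truncated moment `∫_{-1}^s u ^ j k(u) du`. -/
def kernelMoment (k : ℝ → ℝ) (j : ℕ) (s : ℝ) : ℝ :=
  ∫ u in (-1 : ℝ)..s, u ^ j * k u

/-- The coefficient `φ(s)`; see `coefficients_iff`. -/
def coefPhi (k : ℝ → ℝ) (s : ℝ) : ℝ :=
  kernelMoment k 2 s / (kernelMoment k 0 s * kernelMoment k 2 s - kernelMoment k 1 s ^ 2)

/-- The coefficient `ψ(s)`; see `coefficients_iff`. -/
def coefPsi (k : ℝ → ℝ) (s : ℝ) : ℝ :=
  -kernelMoment k 1 s / (kernelMoment k 0 s * kernelMoment k 2 s - kernelMoment k 1 s ^ 2)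

open Classical in
/-- The boundary kernel `k^{(x)}` for the bandwidth `b` on `[0, τ]`. -/
def boundaryKernel (k : ℝ → ℝ) (τ b x u : ℝ) : ℝ :=
  if x ≤ b then coefPhi k (x / b) * k u + coefPsi k (x / b) * (u * k u)
  else if x < τ - b then k u
  else coefPhi k ((τ - x) / b) * k u - coefPsi k ((τ - x) / b) * (u * k u)

/-- The boundary-corrected smoothed Grenander-type estimator
`∫_{(x-b)∨0}^{(x+b)∧τ} b⁻¹ k^{(x)}((x-u)/b) λ̃_n(u) du`. -/
def smoothedGrenander {Ω : Type*} (X C : ℕ → Ω → ℝ) (k : ℝ → ℝ) (τ b : ℝ) (n : ℕ) (ω : Ω)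
    (x : ℝ) : ℝ :=
  ∫ u in (max (x - b) 0)..(min (x + b) τ),
    (b⁻¹ * boundaryKernel k τ b x ((x - u) / b)) * grenander X C τ n ω u

/-! ### The coefficients are the unique solutions of their defining equations -/

theorem IsStandardKernel.integrable {k : ℝ → ℝ} (hk : IsStandardKernel k) : Integrable k := by
  by_contra h
  have := hk.integral_eq_one
  rw [integral_undef h] at this
  exact zero_ne_one this

theorem IsStandardKernel.intervalIntegrable_pow {k : ℝ → ℝ} (hk : IsStandardKernel k) (j : ℕ)
    (a b : ℝ) : IntervalIntegrable (fun u => u ^ j * k u) volume a b :=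
  (hk.integrable.intervalIntegrable).continuousOn_mul (by fun_prop)

theorem IsStandardKernel.moment_zero_pos {k : ℝ → ℝ} (hk : IsStandardKernel k) {s : ℝ}
    (hs : 0 ≤ s) : 0 < kernelMoment k 0 s := by
  have hi : ∀ a b : ℝ, IntervalIntegrable k volume a b :=
    fun a b => hk.integrable.intervalIntegrable
  have h1 : ∫ u in (-1 : ℝ)..1, k u = 1 := by
    rw [intervalIntegral.integral_of_le (by norm_num), ← integral_Icc_eq_integral_Ioc,
      setIntegral_eq_integral_of_forall_compl_eq_zero fun u hu => hk.eq_zero u hu]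
    exact hk.integral_eq_one
  have h2 : ∫ u in (-1 : ℝ)..0, k u = ∫ u in (0 : ℝ)..1, k u := by
    have := intervalIntegral.integral_comp_neg (a := 0) (b := 1) k
    simp only [hk.even, neg_zero] at this
    exact this.symm
  have h3 := intervalIntegral.integral_add_adjacent_intervals (hi (-1) 0) (hi 0 1)
  have h4 := intervalIntegral.integral_add_adjacent_intervals (hi (-1) 0) (hi 0 s)
  have h5 : 0 ≤ ∫ u in (0 : ℝ)..s, k u :=
    intervalIntegral.integral_nonneg hs fun u _ => hk.nonneg u
  simp only [kernelMoment, pow_zero, one_mul]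
  linarith

theorem IsStandardKernel.det_pos {k : ℝ → ℝ} (hk : IsStandardKernel k) {s : ℝ} (hs : 0 ≤ s) :
    0 < kernelMoment k 0 s * kernelMoment k 2 s - kernelMoment k 1 s ^ 2 := by
  have h0 := hk.moment_zero_pos hs
  set m0 := kernelMoment k 0 s with hm0
  set m1 := kernelMoment k 1 s with hm1
  set m2 := kernelMoment k 2 s with hm2
  have hle : (-1 : ℝ) ≤ s := by linarith
  have i0 := hk.intervalIntegrable_pow 0 (-1) s
  have i1 := hk.intervalIntegrable_pow 1 (-1) s
  have i2 := hk.intervalIntegrable_pow 2 (-1) s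
  have hfun : (fun u => (m0 * u - m1) ^ 2 * k u) = fun u =>
      (m0 ^ 2 * (u ^ 2 * k u) - 2 * m0 * m1 * (u ^ 1 * k u)) + m1 ^ 2 * (u ^ 0 * k u) := by
    funext u; ring
  have hii : IntervalIntegrable (fun u => (m0 * u - m1) ^ 2 * k u) volume (-1) s := by
    rw [hfun]
    exact ((i2.const_mul _).sub (i1.const_mul _)).add (i0.const_mul _)
  have hq : ∫ u in (-1 : ℝ)..s, (m0 * u - m1) ^ 2 * k u = m0 * (m0 * m2 - m1 ^ 2) := by
    rw [hfun, intervalIntegral.integral_add ((i2.const_mul _).sub (i1.const_mul _))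
      (i0.const_mul _), intervalIntegral.integral_sub (i2.const_mul _) (i1.const_mul _)]
    simp only [intervalIntegral.integral_const_mul]
    rw [show (∫ u in (-1 : ℝ)..s, u ^ 2 * k u) = m2 from rfl,
      show (∫ u in (-1 : ℝ)..s, u ^ 1 * k u) = m1 from rfl,
      show (∫ u in (-1 : ℝ)..s, u ^ 0 * k u) = m0 from rfl]
    ring
  have hnn : ∀ u, 0 ≤ (m0 * u - m1) ^ 2 * k u := fun u => mul_nonneg (sq_nonneg _) (hk.nonneg u)
  by_contra hD
  have hz : ∫ u in (-1 : ℝ)..s, (m0 * u - m1) ^ 2 * k u = 0 := by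
    apply le_antisymm
    · rw [hq]; exact mul_nonpos_of_nonneg_of_nonpos h0.le (not_lt.mp hD)
    · exact intervalIntegral.integral_nonneg hle fun u _ => hnn u
  have hae := (intervalIntegral.integral_eq_zero_iff_of_le_of_nonneg_ae hle
    (Eventually.of_forall hnn) hii).mp hz
  have hne : ∀ᵐ u ∂(volume.restrict (Ioc (-1 : ℝ) s)), u ≠ m1 / m0 :=
    ae_restrict_of_ae (Measure.ae_ne volume _)
  have hk0 : (fun u => u ^ 0 * k u) =ᵐ[volume.restrict (Ioc (-1 : ℝ) s)] 0 := by
    filter_upwards [hae, hne] with u hu hu'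
    have : m0 * u - m1 ≠ 0 := fun h => hu' (by field_simp; linarith)
    simpa [this] using hu
  have : m0 = 0 := by
    rw [hm0, kernelMoment, intervalIntegral.integral_of_le hle, integral_congr_ae hk0]
    simp
  linarith

/-- For `s ∈ [0, 1]`, the coefficients are the only solution of the two moment equations. -/
theorem coefficients_iff {k : ℝ → ℝ} (hk : IsStandardKernel k) {s : ℝ} (hs : 0 ≤ s)
    (p q : ℝ) :
    ((p * ∫ u in (-1 : ℝ)..s, k u) + (q * ∫ u in (-1 : ℝ)..s, u * k u) = 1 ∧
      (p * ∫ u in (-1 : ℝ)..s, u * k u) + (q * ∫ u in (-1 : ℝ)..s, u ^ 2 * k u) = 0) ↔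
      p = coefPhi k s ∧ q = coefPsi k s := by
  have hD := hk.det_pos hs
  have e0 : (∫ u in (-1 : ℝ)..s, k u) = kernelMoment k 0 s := by simp [kernelMoment]
  have e1 : (∫ u in (-1 : ℝ)..s, u * k u) = kernelMoment k 1 s := by simp [kernelMoment]
  have e2 : (∫ u in (-1 : ℝ)..s, u ^ 2 * k u) = kernelMoment k 2 s := rfl
  rw [e0, e1, e2, coefPhi, coefPsi, eq_div_iff hD.ne', eq_div_iff hD.ne']
  set m0 := kernelMoment k 0 s
  set m1 := kernelMoment k 1 s
  set m2 := kernelMoment k 2 s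
  constructor
  · rintro ⟨h1, h2⟩
    constructor
    · linear_combination m2 * h1 - m1 * h2
    · linear_combination m0 * h2 - m1 * h1
  · rintro ⟨h1, h2⟩
    constructor
    · apply mul_right_cancel₀ hD.ne'
      linear_combination m0 * h1 + m1 * h2
    · apply mul_right_cancel₀ hD.ne'
      linear_combination m1 * h1 + m2 * h2

end SmoothedGrenander

end

/-!
Write `A` for the Nelson-Aalen estimator, `Λ` for the primitive of the hazard `λ`, and `S` for the
left-hand slope of the greatest convex minorant of `A`. The slope `S` is nonnegative and
nondecreasing, being the left derivative of a convex function, so that a chord of fixed length `δ`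
bounds it from above, and one to its left bounds it from below. The minorant is at most `A` and at
least every affine function below `A`, in particular the tangents of the convex function `Λ`,
lowered by a constant. Hence uniform closeness of `A` to `Λ` on an interval `[0, M₂]` with `M₂`
close to `τ` makes `S` uniformly close to `λ` on `[δ, M']`, and on `(0, δ)` not much larger than
`λ`. No rate of convergence is needed there; the remaining piece `[M₂, τ]` is harmless because `A`
is monotone and `λ` is bounded.

Uniform closeness follows from consistency at finitely many points
(`exists_finset_of_continuousOn`). At a point, `A` is compared with the empirical mean of
`1_{T ≤ t} Δ / y(T)`, where `y(s) = P(T ≥ s)`: the expectation of this mean is `Λ(t)`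
(`integral_deathInd_div`), and the fraction of subjects at risk is uniformly close to `y`.

Near the origin the slope may stay inconsistent, but only on a zone that is short compared with
the bandwidth `b`. For `u ≥ r = ρ b` the chord of the minorant from `0` to `u` bounds `S u` from
below by almost `λ(0)` as soon as `A t ≥ (λ(0) - η) t - η r` for all small `t`
(`le_minorantSlope_of_affine_le`). As `A` dominates the fraction of deaths before `t`, whose mean
is at least `(λ(0) - η / 2) t` and whose variance is `O(t / n)`, Chebyshev's inequality on a grid
of step proportional to `r` bounds the failure probability by a multiple of `1 / (n r²)`, which
tends to zero because `α < 1/2` (`exists_vanishing_nelsonAalen_lt`).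

Finally, the boundary kernels have mass one and size `O(1 / b)`, so that averaging `S` reproduces
`λ(x)` up to a multiple of `η` plus the contribution `O(r / b) = O(ρ)` of the short zone
(`abs_smoothed_minorantSlope_sub_le`).

No measurability of the supremum is needed, since the events are bounded by outer measure.
-/

noncomputable section

namespace SmoothedGrenander

/-! ### Greatest convex minorants and their left-hand slopes -/

section Minorant

variable {s : Set ℝ} {φ : ℝ → ℝ}

theorem bddAbove_minorant_values {t : ℝ} (ht : t ∈ s) :
    BddAbove {y : ℝ | ∃ h : ℝ → ℝ, ConvexOn ℝ s h ∧ (∀ u ∈ s, h u ≤ φ u) ∧ y = h t} :=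
  ⟨φ t, by rintro _ ⟨h, -, hle, rfl⟩; exact hle t ht⟩

theorem le_greatestConvexMinorant {h : ℝ → ℝ} (hc : ConvexOn ℝ s h) (hle : ∀ u ∈ s, h u ≤ φ u)
    {t : ℝ} (ht : t ∈ s) : h t ≤ greatestConvexMinorant s φ t :=
  le_csSup (bddAbove_minorant_values ht) ⟨h, hc, hle, rfl⟩

theorem greatestConvexMinorant_le (hs : Convex ℝ s) (hφ : ∀ u ∈ s, 0 ≤ φ u) {t : ℝ}
    (ht : t ∈ s) : greatestConvexMinorant s φ t ≤ φ t := by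
  refine csSup_le ⟨0, fun _ => 0, convexOn_const 0 hs, hφ, rfl⟩ ?_
  rintro _ ⟨h, -, hle, rfl⟩
  exact hle t ht

theorem convexOn_greatestConvexMinorant (hs : Convex ℝ s) (hφ : ∀ u ∈ s, 0 ≤ φ u) :
    ConvexOn ℝ s (greatestConvexMinorant s φ) := by
  refine ⟨hs, fun x hx y hy a b ha hb hab => ?_⟩
  refine csSup_le ⟨0, fun _ => 0, convexOn_const 0 hs, hφ, rfl⟩ ?_
  rintro _ ⟨h, hc, hle, rfl⟩
  refine (hc.2 hx hy ha hb hab).trans ?_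
  simp only [smul_eq_mul]
  gcongr
  · exact le_greatestConvexMinorant hc hle hx
  · exact le_greatestConvexMinorant hc hle hy

end Minorant

/-- The left-hand slope at `u` of the greatest convex minorant of `A` on `[0, τ]`. -/
def minorantSlope (τ : ℝ) (A : ℝ → ℝ) (u : ℝ) : ℝ :=
  derivWithin (greatestConvexMinorant (Icc 0 τ) A) (Iio u) u

section Slope

variable {τ : ℝ} {A : ℝ → ℝ}

theorem monotoneOn_minorantSlope (hA : ∀ u ∈ Icc 0 τ, 0 ≤ A u) :
    MonotoneOn (minorantSlope τ A) (Ioo 0 τ) := by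
  have := (convexOn_greatestConvexMinorant (convex_Icc 0 τ) hA).monotoneOn_leftDeriv
  rwa [interior_Icc] at this

theorem minorant_increment_le_slope (hA : ∀ u ∈ Icc 0 τ, 0 ≤ A u) {v u : ℝ} (hv : 0 ≤ v)
    (hvu : v < u) (hu : u < τ) :
    greatestConvexMinorant (Icc 0 τ) A u - greatestConvexMinorant (Icc 0 τ) A v ≤
      minorantSlope τ A u * (u - v) := by
  have h := (convexOn_greatestConvexMinorant (convex_Icc 0 τ) hA).slope_le_leftDeriv_of_mem_interior
    (x := v) (y := u) ⟨hv, by linarith⟩ (by rw [interior_Icc]; exact ⟨by linarith, hu⟩) hvu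
  rw [slope_def_field, div_le_iff₀ (by linarith)] at h
  exact h

theorem minorant_slope_le_increment (hA : ∀ u ∈ Icc 0 τ, 0 ≤ A u) {u w : ℝ} (hu : 0 < u)
    (huw : u < w) (hw : w ≤ τ) :
    minorantSlope τ A u * (w - u) ≤
      greatestConvexMinorant (Icc 0 τ) A w - greatestConvexMinorant (Icc 0 τ) A u := by
  have hc := convexOn_greatestConvexMinorant (convex_Icc 0 τ) hA
  have hi : u ∈ interior (Icc 0 τ) := by rw [interior_Icc]; exact ⟨hu, by linarith⟩
  have hl := hc.leftDeriv_le_rightDeriv_of_mem_interior hi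
  have hr := hc.le_slope_of_hasDerivWithinAt_Ioi (interior_subset hi)
    (show w ∈ Icc 0 τ from ⟨by linarith, hw⟩) huw (hc.hasDerivWithinAt_rightDeriv_of_mem_interior hi)
  have h := hl.trans hr
  rw [slope_def_field, le_div_iff₀ (by linarith)] at h
  exact h

theorem convexOn_affine {s : Set ℝ} (hs : Convex ℝ s) (m h : ℝ) :
    ConvexOn ℝ s fun t => m * t - h := by
  refine ⟨hs, fun x _ y _ a b _ _ hab => le_of_eq ?_⟩
  simp only [smul_eq_mul]
  linear_combination h * hab

/-- An affine function below `A` bounds the left-hand slope of the minorant from below, through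
the chord that starts at `0`. -/
theorem le_minorantSlope_of_affine_le (hA : ∀ u ∈ Icc 0 τ, 0 ≤ A u) (hA0 : A 0 = 0) {m h u : ℝ}
    (hle : ∀ t ∈ Icc 0 τ, m * t - h ≤ A t) (hu : 0 < u) (huτ : u < τ) :
    m * u - h ≤ minorantSlope τ A u * u := by
  have h1 := le_greatestConvexMinorant (convexOn_affine (convex_Icc 0 τ) m h) hle
    (show u ∈ Icc 0 τ from ⟨hu.le, huτ.le⟩)
  have h2 := greatestConvexMinorant_le (convex_Icc 0 τ) hA
    (show (0 : ℝ) ∈ Icc 0 τ from ⟨le_rfl, by linarith⟩)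
  have h3 := minorant_increment_le_slope hA le_rfl hu huτ
  rw [sub_zero] at h3
  linarith

theorem minorantSlope_nonneg (hA : ∀ u ∈ Icc 0 τ, 0 ≤ A u) (hA0 : A 0 = 0) {u : ℝ}
    (hu : 0 < u) (huτ : u < τ) : 0 ≤ minorantSlope τ A u := by
  have := le_minorantSlope_of_affine_le (m := 0) (h := 0) hA hA0 (by simpa using hA) hu huτ
  simp only [zero_mul, sub_zero] at this
  exact nonneg_of_mul_nonneg_left this hu

end Slope

/-! ### Hazard functions and their primitives -/

/-- A nondecreasing nonnegative function `lam` on `[0, τ)` with its primitive `Lam`. Being a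
primitive enters only through the bounds of an increment of `Lam` by the values of `lam` at the
two end points, which is all that the analysis of the left-hand slopes uses. -/
structure IsMonotonePrimitive (τ : ℝ) (lam Lam : ℝ → ℝ) : Prop where
  mono : MonotoneOn lam (Ico 0 τ)
  nonneg : ∀ t ∈ Ico 0 τ, 0 ≤ lam t
  zero : Lam 0 = 0
  lower : ∀ s t, 0 ≤ s → s ≤ t → t < τ → lam s * (t - s) ≤ Lam t - Lam s
  upper : ∀ s t, 0 ≤ s → s ≤ t → t < τ → Lam t - Lam s ≤ lam t * (t - s)

theorem isMonotonePrimitive_integral {τ : ℝ} {lam : ℝ → ℝ} (hm : MonotoneOn lam (Ico 0 τ))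
    (h0 : ∀ t ∈ Ico 0 τ, 0 ≤ lam t) :
    IsMonotonePrimitive τ lam fun t => ∫ s in (0 : ℝ)..t, lam s := by
  have hi : ∀ s t, 0 ≤ s → s ≤ t → t < τ → IntervalIntegrable lam volume s t := by
    intro s t hs hst ht
    apply MonotoneOn.intervalIntegrable
    rw [uIcc_of_le hst]
    exact hm.mono fun x hx => ⟨hs.trans hx.1, hx.2.trans_lt ht⟩
  have hsub : ∀ s t, 0 ≤ s → s ≤ t → t < τ →
      (∫ x in (0 : ℝ)..t, lam x) - (∫ x in (0 : ℝ)..s, lam x) = ∫ x in s..t, lam x := by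
    intro s t hs hst ht
    rw [← intervalIntegral.integral_add_adjacent_intervals (hi 0 s le_rfl hs (by linarith))
      (hi s t hs hst ht)]
    ring
  refine ⟨hm, h0, by simp, fun s t hs hst ht => ?_, fun s t hs hst ht => ?_⟩
  · rw [hsub s t hs hst ht]
    have := intervalIntegral.integral_mono_on hst
      (intervalIntegrable_const (c := lam s)) (hi s t hs hst ht)
      fun x hx => hm ⟨hs, by linarith⟩ ⟨hs.trans hx.1, hx.2.trans_lt ht⟩ hx.1
    rw [intervalIntegral.integral_const, smul_eq_mul] at this
    linarith
  · rw [hsub s t hs hst ht]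
    have := intervalIntegral.integral_mono_on hst (hi s t hs hst ht)
      (intervalIntegrable_const (c := lam t))
      fun x hx => hm ⟨hs.trans hx.1, hx.2.trans_lt ht⟩ ⟨hs.trans hst, ht⟩ hx.2
    rw [intervalIntegral.integral_const, smul_eq_mul] at this
    linarith

theorem exists_bound_of_monotoneOn_uniformContinuousOn {τ : ℝ} {lam : ℝ → ℝ} (hτ : 0 < τ)
    (hm : MonotoneOn lam (Ico 0 τ)) (hu : UniformContinuousOn lam (Ico 0 τ)) :
    ∃ L, 0 < L ∧ ∀ t ∈ Ico 0 τ, lam t ≤ L := by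
  obtain ⟨δ, hδ, h⟩ := Metric.uniformContinuousOn_iff.mp hu 1 one_pos
  set t₀ := max 0 (τ - δ / 2) with ht₀
  have hmem : t₀ ∈ Ico 0 τ := ⟨le_max_left _ _, max_lt hτ (by linarith)⟩
  refine ⟨max 0 (lam t₀) + 1, by positivity, fun t ht => ?_⟩
  have h1 := le_max_right 0 (lam t₀)
  rcases le_total t t₀ with htt | htt
  · linarith [hm ht hmem htt]
  · have h2 := h t ht t₀ hmem (by
      rw [Real.dist_eq, abs_of_nonneg (by linarith)]
      linarith [ht.2, le_max_right 0 (τ - δ / 2)])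
    rw [Real.dist_eq] at h2
    linarith [(abs_lt.mp h2).2]

namespace IsMonotonePrimitive

variable {τ : ℝ} {lam Lam : ℝ → ℝ}

theorem tangent_le (h : IsMonotonePrimitive τ lam Lam) {u t : ℝ} (hu : 0 ≤ u) (hu' : u < τ)
    (ht : 0 ≤ t) (ht' : t < τ) : Lam u + lam u * (t - u) ≤ Lam t := by
  rcases le_total u t with hut | hut
  · linarith [h.lower u t hu hut ht']
  · linarith [h.upper t u ht hut hu', show lam u * (t - u) = -(lam u * (u - t)) by ring]

variable {A : ℝ → ℝ} {L M κ : ℝ}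

/-- If `A` is monotone and close to `Λ` on `[0, M]` and little hazard remains on `[M, τ]`, then
`A` stays above the tangents of `Λ`, up to a small constant, on all of `[0, τ]`. -/
theorem tangent_le_of_close (h : IsMonotonePrimitive τ lam Lam) (hM : 0 ≤ M) (hMτ : M < τ)
    (hL : ∀ t ∈ Ico 0 τ, lam t ≤ L) (hLM : L * (τ - M) ≤ κ) (hmono : Monotone A)
    (hclose : ∀ t ∈ Icc 0 M, |A t - Lam t| ≤ κ) {u t : ℝ} (hu : 0 ≤ u) (hu' : u < τ)
    (ht : t ∈ Icc 0 τ) : lam u * t - (lam u * u - Lam u + 2 * κ) ≤ A t := by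
  have hκ : 0 ≤ κ := (abs_nonneg _).trans (hclose 0 ⟨le_rfl, hM⟩)
  rcases le_total t M with htM | htM
  · have h1 := h.tangent_le hu hu' ht.1 (htM.trans_lt hMτ)
    have h2 := (abs_le.mp (hclose t ⟨ht.1, htM⟩)).1
    linarith
  · have h1 := h.tangent_le hu hu' hM hMτ
    have h2 := (abs_le.mp (hclose M ⟨hM, le_rfl⟩)).1
    have h3 := hmono htM
    have h4 : lam u * (t - M) ≤ L * (τ - M) := by
      have := hL u ⟨hu, hu'⟩
      have := h.nonneg u ⟨hu, hu'⟩
      apply mul_le_mul <;> linarith [ht.2]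
    linarith

theorem minorant_ge_of_close (h : IsMonotonePrimitive τ lam Lam) (hM : 0 ≤ M) (hMτ : M < τ)
    (hL : ∀ t ∈ Ico 0 τ, lam t ≤ L) (hLM : L * (τ - M) ≤ κ) (hmono : Monotone A)
    (hclose : ∀ t ∈ Icc 0 M, |A t - Lam t| ≤ κ) {u : ℝ} (hu : 0 ≤ u) (hu' : u < τ) :
    Lam u - 2 * κ ≤ greatestConvexMinorant (Icc 0 τ) A u := by
  have := le_greatestConvexMinorant (convexOn_affine (convex_Icc 0 τ) _ _)
    (fun t ht => h.tangent_le_of_close hM hMτ hL hLM hmono hclose hu hu' ht)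
    (show u ∈ Icc 0 τ from ⟨hu, hu'.le⟩)
  linarith

theorem minorantSlope_le (h : IsMonotonePrimitive τ lam Lam) (hM : 0 ≤ M) (hMτ : M < τ)
    (hL : ∀ t ∈ Ico 0 τ, lam t ≤ L) (hLM : L * (τ - M) ≤ κ) (hmono : Monotone A)
    (hA : ∀ u ∈ Icc 0 τ, 0 ≤ A u)
    (hclose : ∀ t ∈ Icc 0 M, |A t - Lam t| ≤ κ) {u δ : ℝ} (hu : 0 < u) (hδ : 0 < δ)
    (huM : u + δ ≤ M) : minorantSlope τ A u ≤ lam (u + δ) + 3 * κ / δ := by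
  have h1 := minorant_slope_le_increment hA hu (w := u + δ) (by linarith) (by linarith)
  have h2 := greatestConvexMinorant_le (convex_Icc 0 τ) hA
    (show u + δ ∈ Icc 0 τ from ⟨by linarith, by linarith⟩)
  have h3 := h.minorant_ge_of_close hM hMτ hL hLM hmono hclose hu.le (by linarith)
  have h4 := (abs_le.mp (hclose (u + δ) ⟨by linarith, huM⟩)).2
  have h5 := h.upper u (u + δ) hu.le (by linarith) (by linarith)
  rw [add_sub_cancel_left] at h1 h5
  have : lam (u + δ) + 3 * κ / δ - minorantSlope τ A u =
    (lam (u + δ) * δ + 3 * κ - minorantSlope τ A u * δ) / δ := by field_simp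
  rw [← sub_nonneg, this]
  apply div_nonneg _ hδ.le
  linarith

theorem le_minorantSlope (h : IsMonotonePrimitive τ lam Lam) (hM : 0 ≤ M) (hMτ : M < τ)
    (hL : ∀ t ∈ Ico 0 τ, lam t ≤ L) (hLM : L * (τ - M) ≤ κ) (hmono : Monotone A)
    (hA : ∀ u ∈ Icc 0 τ, 0 ≤ A u)
    (hclose : ∀ t ∈ Icc 0 M, |A t - Lam t| ≤ κ) {u δ : ℝ} (hδ : 0 < δ) (hu : δ ≤ u)
    (huM : u ≤ M) : lam (u - δ) - 3 * κ / δ ≤ minorantSlope τ A u := by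
  have h1 := minorant_increment_le_slope hA (v := u - δ) (u := u) (by linarith) (by linarith)
    (by linarith)
  have h2 := greatestConvexMinorant_le (convex_Icc 0 τ) hA
    (show u - δ ∈ Icc 0 τ from ⟨by linarith, by linarith⟩)
  have h3 := h.minorant_ge_of_close hM hMτ hL hLM hmono hclose (u := u) (by linarith)
    (by linarith)
  have h4 := (abs_le.mp (hclose (u - δ) ⟨by linarith, by linarith⟩)).2
  have h5 := h.lower (u - δ) u (by linarith) (by linarith) (by linarith)
  rw [sub_sub_cancel] at h1 h5
  have : minorantSlope τ A u - (lam (u - δ) - 3 * κ / δ) =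
    (minorantSlope τ A u * δ + 3 * κ - lam (u - δ) * δ) / δ := by field_simp; ring
  rw [← sub_nonneg, this]
  apply div_nonneg _ hδ.le
  linarith

/-- Closeness of the slope to the hazard, away from a boundary zone `(0, r)`. The chords of
fixed length `δ` control the slope on `[δ, M']`, and from above everywhere; on `[r, δ]` the lower
bound comes from the chord that starts at `0`, hence the sharper requirement on `A` there. -/
theorem exists_forall_abs_minorantSlope_sub_le (h : IsMonotonePrimitive τ lam Lam)
    (hunif : UniformContinuousOn lam (Ico 0 τ)) (hL0 : 0 < L) (hL : ∀ t ∈ Ico 0 τ, lam t ≤ L)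
    {M' : ℝ} (hM'0 : 0 < M') (hM' : M' < τ) {η δ₀ : ℝ} (hη : 0 < η) (hδ₀ : 0 < δ₀) :
    ∃ δ M κ, 0 < δ ∧ δ ≤ δ₀ ∧ M' < M ∧ M < τ ∧ 0 < κ ∧ ∀ A : ℝ → ℝ, Monotone A →
      (∀ u ∈ Icc 0 τ, 0 ≤ A u) → A 0 = 0 → (∀ t ∈ Icc 0 M, |A t - Lam t| ≤ κ) →
      ∀ r : ℝ, 0 < r → (∀ t ∈ Icc 0 δ, (lam 0 - η) * t - η * r ≤ A t) →
        ∀ u ∈ Icc r M', |minorantSlope τ A u - lam u| ≤ 3 * η := by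
  obtain ⟨d, hd, hud⟩ := Metric.uniformContinuousOn_iff.mp hunif η hη
  set δ := min (min (d / 2) δ₀) ((τ - M') / 2) with hδdef
  have hδ : 0 < δ := lt_min (lt_min (by positivity) hδ₀) (by linarith)
  have hδd : δ < d := by
    have := (min_le_left _ _).trans (min_le_left _ _) |>.trans_eq' hδdef
    linarith
  have hδδ : δ ≤ δ₀ := (min_le_left _ _).trans (min_le_right _ _)
  have hδM : δ ≤ (τ - M') / 2 := min_le_right _ _
  set κ := η * δ / 3 with hκdef
  have hκ : 0 < κ := by positivity
  set M := max (M' + δ) (τ - κ / L) with hMdef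
  have hM1 : M' + δ ≤ M := le_max_left _ _
  have hMτ : M < τ := max_lt (by linarith) (by have : 0 < κ / L := by positivity
                                               linarith)
  have hLM : L * (τ - M) ≤ κ := by
    have h1 : τ - κ / L ≤ M := le_max_right _ _
    have h2 : τ - M ≤ κ / L := by linarith
    rwa [le_div_iff₀ hL0, mul_comm] at h2
  have hκδ : 3 * κ / δ = η := by rw [hκdef]; field_simp
  refine ⟨δ, M, κ, hδ, hδδ, by linarith, hMτ, hκ, ?_⟩
  intro A hmono hA hA0 hclose r hr hrd u hu
  have hu0 : 0 < u := hr.trans_le hu.1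
  have hM0 : 0 ≤ M := by linarith
  have huτ : u ∈ Ico 0 τ := ⟨hu0.le, by linarith [hu.2]⟩
  have hnear : ∀ v ∈ Ico 0 τ, |v - u| ≤ δ → |lam v - lam u| < η := fun v hv hvu =>
    hud v hv u huτ (by rw [Real.dist_eq]; linarith)
  rw [abs_le]
  constructor
  · rcases le_total δ u with hδu | hδu
    · have h1 := h.le_minorantSlope hM0 hMτ hL hLM hmono hA hclose hδ hδu (by linarith [hu.2])
      have h2 := abs_lt.mp (hnear (u - δ) ⟨by linarith, by linarith [hu.2]⟩
        (by rw [sub_sub_cancel_left, abs_neg, abs_of_pos hδ]))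
      rw [hκδ] at h1
      linarith
    · have h1 : ∀ t ∈ Icc 0 τ, (lam 0 - η) * t - η * r ≤ A t := by
        intro t ht
        rcases le_total t δ with htδ | htδ
        · exact hrd t ⟨ht.1, htδ⟩
        · have h2 := h.tangent_le_of_close hM0 hMτ hL hLM hmono hclose (u := 0) le_rfl
            (by linarith) ht
          rw [h.zero] at h2
          have h3 : η * δ ≤ η * t := by gcongr
          have h4 : 0 < η * r := by positivity
          linarith [show (lam 0 - η) * t = lam 0 * t - η * t by ring]
      have h2 := le_minorantSlope_of_affine_le hA hA0 h1 hu0 huτ.2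
      have h3 : η * r ≤ η * u := by gcongr; exact hu.1
      have h4 : lam 0 - 2 * η ≤ minorantSlope τ A u := by
        refine le_of_mul_le_mul_right ?_ hu0
        linarith
      have h5 := abs_lt.mp (hnear 0 ⟨le_rfl, by linarith⟩
        (by rw [zero_sub, abs_neg, abs_of_pos hu0]; exact hδu))
      linarith
  · have h1 := h.minorantSlope_le hM0 hMτ hL hLM hmono hA hclose hu0 hδ (by linarith [hu.2])
    have h2 := abs_lt.mp (hnear (u + δ) ⟨by linarith, by linarith [hu.2]⟩
      (by rw [add_sub_cancel_left, abs_of_pos hδ]))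
    rw [hκδ] at h1
    linarith

end IsMonotonePrimitive

/-! ### Monotone functions close to a continuous function at finitely many points -/

/-- Pólya's device: a monotone function that is close to a uniformly continuous one at the points
of a suitable finite set is close to it on the whole interval. -/
theorem exists_finset_of_continuousOn {F : ℝ → ℝ} {a b : ℝ} (hab : a ≤ b)
    (hF : ContinuousOn F (Icc a b)) {η : ℝ} (hη : 0 < η) :
    ∃ Q : Finset ℝ, (∀ q ∈ Q, q ∈ Icc a b) ∧ ∀ G : ℝ → ℝ, MonotoneOn G (Icc a b) →
      (∀ q ∈ Q, |G q - F q| ≤ η) → ∀ t ∈ Icc a b, |G t - F t| ≤ 2 * η := by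
  obtain ⟨δ, hδ, h⟩ := Metric.uniformContinuousOn_iff.mp
    (isCompact_Icc.uniformContinuousOn_of_continuous hF) η hη
  set d := δ / 2 with hd
  have hd0 : 0 < d := by positivity
  set p : ℕ → ℝ := fun i => min (a + i * d) b with hp
  have hpmem : ∀ i, p i ∈ Icc a b := fun i =>
    ⟨le_min (by have : 0 ≤ (i : ℝ) * d := by positivity
                linarith) hab, min_le_right _ _⟩
  refine ⟨(Finset.range (⌊(b - a) / d⌋₊ + 2)).image p, ?_, ?_⟩
  · intro q hq
    obtain ⟨i, -, rfl⟩ := Finset.mem_image.mp hq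
    exact hpmem i
  intro G hG hQ t ht
  set i := ⌊(t - a) / d⌋₊ with hi
  have h0 : 0 ≤ (t - a) / d := div_nonneg (by linarith [ht.1]) hd0.le
  have hi1 : a + i * d ≤ t := by
    have := Nat.floor_le h0
    rw [← hi, le_div_iff₀ hd0] at this
    linarith
  have hi2 : t < a + (i + 1 : ℕ) * d := by
    have := Nat.lt_floor_add_one ((t - a) / d)
    rw [← hi, div_lt_iff₀ hd0] at this
    push_cast
    linarith
  have hib : i ≤ ⌊(b - a) / d⌋₊ := by
    apply Nat.floor_le_floor
    gcongr
    exact ht.2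
  have hl : p i = a + i * d := min_eq_left (hi1.trans ht.2)
  have hlt : p i ≤ t := hl ▸ hi1
  have htr : t ≤ p (i + 1) := le_min hi2.le ht.2
  have hw : p (i + 1) ≤ p i + d := by
    rw [hl]
    refine (min_le_left _ _).trans ?_
    push_cast
    linarith
  have q1 := abs_le.mp (hQ (p i) (Finset.mem_image_of_mem p (Finset.mem_range.mpr (by omega))))
  have q2 := abs_le.mp (hQ (p (i + 1))
    (Finset.mem_image_of_mem p (Finset.mem_range.mpr (by omega))))
  have c1 := h (p i) (hpmem i) t ht (by rw [Real.dist_eq, abs_lt]; constructor <;> linarith)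
  have c2 := h (p (i + 1)) (hpmem _) t ht (by rw [Real.dist_eq, abs_lt]; constructor <;> linarith)
  rw [Real.dist_eq, abs_lt] at c1 c2
  have g1 := hG (hpmem i) ht hlt
  have g2 := hG ht (hpmem (i + 1)) htr
  rw [abs_le]
  constructor <;> linarith

/-! ### Boundary kernels -/

section Kernel

variable {k : ℝ → ℝ}

theorem IsStandardKernel.exists_bound (hk : IsStandardKernel k)
    (hd : DifferentiableOn ℝ k (Ioo (-1) 1))
    (hb : ∃ K : ℝ, ∀ u ∈ Ioo (-1 : ℝ) 1, |deriv k u| ≤ K) : ∃ B, 0 < B ∧ ∀ u, k u ≤ B := by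
  obtain ⟨K, hK⟩ := hb
  have hK0 : 0 ≤ K := (abs_nonneg _).trans (hK 0 (by norm_num))
  have h0 := hk.nonneg 0
  have h1 := hk.nonneg 1
  refine ⟨k 0 + K + k 1 + 1, by linarith, fun u => ?_⟩
  by_cases hu : u ∈ Ioo (-1 : ℝ) 1
  · have h := (convex_Ioo (-1 : ℝ) 1).norm_image_sub_le_of_norm_deriv_le (f := k) (C := K)
      (fun x hx => (hd x hx).differentiableAt (isOpen_Ioo.mem_nhds hx)) hK
      (show (0 : ℝ) ∈ Ioo (-1 : ℝ) 1 by norm_num) hu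
    rw [Real.norm_eq_abs, Real.norm_eq_abs, sub_zero] at h
    have h2 : K * |u| ≤ K * 1 := by gcongr; exact (abs_lt.mpr hu).le
    linarith [le_abs_self (k u - k 0)]
  · by_cases hu' : u ∈ Icc (-1 : ℝ) 1
    · have : u = -1 ∨ u = 1 := by
        rcases eq_or_lt_of_le hu'.1 with h | h
        · exact Or.inl h.symm
        · exact Or.inr (le_antisymm hu'.2 (not_lt.mp fun h' => hu ⟨h, h'⟩))
      rcases this with rfl | rfl
      · rw [hk.even]; linarith
      · linarith
    · rw [hk.eq_zero u hu']; linarith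

theorem IsStandardKernel.abs_mul_le (hk : IsStandardKernel k) (u : ℝ) : |u * k u| ≤ k u := by
  by_cases hu : u ∈ Icc (-1 : ℝ) 1
  · rw [abs_mul, abs_of_nonneg (hk.nonneg u)]
    exact mul_le_of_le_one_left (hk.nonneg u) (abs_le.mpr hu)
  · simp [hk.eq_zero u hu]

theorem IsStandardKernel.integrable_mul (hk : IsStandardKernel k) :
    Integrable fun u => u * k u :=
  hk.integrable.mono (continuous_id.aestronglyMeasurable.mul hk.integrable.1)
    (Eventually.of_forall fun u => by
      rw [Real.norm_eq_abs, Real.norm_eq_abs, abs_of_nonneg (hk.nonneg u)]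
      exact hk.abs_mul_le u)

theorem IsStandardKernel.continuous_moment (hk : IsStandardKernel k) (j : ℕ) :
    Continuous (kernelMoment k j) :=
  intervalIntegral.continuous_primitive (fun a b => hk.intervalIntegrable_pow j a b) (-1)

theorem IsStandardKernel.exists_coef_bound (hk : IsStandardKernel k) :
    ∃ D, 0 < D ∧ ∀ s ∈ Icc (0 : ℝ) 1, |coefPhi k s| ≤ D ∧ |coefPsi k s| ≤ D := by
  have hne : ∀ s ∈ Icc (0 : ℝ) 1,
      kernelMoment k 0 s * kernelMoment k 2 s - kernelMoment k 1 s ^ 2 ≠ 0 :=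
    fun s hs => (hk.det_pos hs.1).ne'
  have hdet : ContinuousOn
      (fun s => kernelMoment k 0 s * kernelMoment k 2 s - kernelMoment k 1 s ^ 2) (Icc 0 1) :=
    (((hk.continuous_moment 0).mul (hk.continuous_moment 2)).sub
      ((hk.continuous_moment 1).pow 2)).continuousOn
  obtain ⟨D₁, h₁⟩ := isCompact_Icc.exists_bound_of_continuousOn
    ((hk.continuous_moment 2).continuousOn.div hdet hne)
  obtain ⟨D₂, h₂⟩ := isCompact_Icc.exists_bound_of_continuousOn
    ((hk.continuous_moment 1).neg.continuousOn.div hdet hne)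
  refine ⟨max (max D₁ D₂) 1, by positivity, fun s hs => ⟨?_, ?_⟩⟩
  · exact (h₁ s hs).trans ((le_max_left _ _).trans (le_max_left _ _))
  · exact (h₂ s hs).trans ((le_max_right _ _).trans (le_max_left _ _))

theorem IsStandardKernel.exists_boundaryKernel_bound (hk : IsStandardKernel k)
    (hd : DifferentiableOn ℝ k (Ioo (-1) 1))
    (hb : ∃ K : ℝ, ∀ u ∈ Ioo (-1 : ℝ) 1, |deriv k u| ≤ K) :
    ∃ B, 0 < B ∧ ∀ τ b x u : ℝ, 0 < b → 0 ≤ x → x < τ - b → |boundaryKernel k τ b x u| ≤ B := by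
  obtain ⟨B, hB, hkB⟩ := hk.exists_bound hd hb
  obtain ⟨D, hD, hcoef⟩ := hk.exists_coef_bound
  refine ⟨2 * D * B + B, by positivity, fun τ b x u hb0 hx hxτ => ?_⟩
  have hku : |k u| ≤ B := by rw [abs_of_nonneg (hk.nonneg u)]; exact hkB u
  unfold boundaryKernel
  split_ifs with h
  · obtain ⟨h1, h2⟩ := hcoef (x / b) ⟨by positivity, (div_le_one hb0).mpr h⟩
    refine (abs_add_le _ _).trans ?_
    rw [abs_mul, abs_mul]
    have h3 : |coefPhi k (x / b)| * |k u| ≤ D * B := by gcongr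
    have h4 : |coefPsi k (x / b)| * |u * k u| ≤ D * B := by
      gcongr
      exact (hk.abs_mul_le u).trans (hkB u)
    linarith
  · have : 0 < 2 * D * B := by positivity
    linarith

theorem IsStandardKernel.integrable_boundaryKernel (hk : IsStandardKernel k) (τ b x : ℝ) :
    Integrable (boundaryKernel k τ b x) := by
  unfold boundaryKernel
  split_ifs
  · exact (hk.integrable.const_mul _).add (hk.integrable_mul.const_mul _)
  · exact hk.integrable
  · exact (hk.integrable.const_mul _).sub (hk.integrable_mul.const_mul _)

theorem IsStandardKernel.integrable_scaled_boundaryKernel (hk : IsStandardKernel k) (τ x : ℝ)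
    {b : ℝ} (hb : 0 < b) :
    Integrable fun u => b⁻¹ * boundaryKernel k τ b x ((x - u) / b) :=
  (((hk.integrable_boundaryKernel τ b x).comp_div hb.ne').comp_sub_left x).const_mul _

/-- The boundary kernels are corrected so as to have total mass one near the left end point. -/
theorem IsStandardKernel.integral_boundaryKernel (hk : IsStandardKernel k) {τ b x : ℝ}
    (hb : 0 < b) (hx : 0 ≤ x) (hxτ : x < τ - b) :
    ∫ u in (max (x - b) 0)..(x + b), b⁻¹ * boundaryKernel k τ b x ((x - u) / b) = 1 := by
  have hscale : ∀ (F : ℝ → ℝ) (a : ℝ), ∫ u in a..(x + b), b⁻¹ * F ((x - u) / b) =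
      ∫ v in (-1)..((x - a) / b), F v := by
    intro F a
    have h := intervalIntegral.integral_comp_sub_div (a := a) (b := x + b) F hb.ne' (x / b)
    simp only [← sub_div] at h
    rw [intervalIntegral.integral_const_mul, h, smul_eq_mul, inv_mul_cancel_left₀ hb.ne']
    congr 1
    field_simp
    ring
  rw [hscale]
  unfold boundaryKernel
  split_ifs with h
  · have hs : (0 : ℝ) ≤ x / b := by positivity
    have h1 := ((coefficients_iff hk hs (coefPhi k (x / b)) (coefPsi k (x / b))).mpr ⟨rfl, rfl⟩).1
    rw [max_eq_right (by linarith), sub_zero, intervalIntegral.integral_add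
      (hk.integrable.const_mul _).intervalIntegrable
      (hk.integrable_mul.const_mul _).intervalIntegrable,
      intervalIntegral.integral_const_mul, intervalIntegral.integral_const_mul, h1]
  · rw [max_eq_left (by linarith), sub_sub_cancel, div_self hb.ne',
      intervalIntegral.integral_of_le (by norm_num), ← integral_Icc_eq_integral_Ioc,
      setIntegral_eq_integral_of_forall_compl_eq_zero fun u hu => hk.eq_zero u hu]
    exact hk.integral_eq_one

end Kernel

/-! ### Averaging a function against a kernel of mass one -/

/-- Averaging `S` against a weight of mass one and size `β` reproduces the value `l` if `S` is
close to `l` except on a short zone `(0, r)`, where it is only bounded. -/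
theorem abs_integral_mul_sub_le {w S : ℝ → ℝ} {a c l β η D r : ℝ} (ha : 0 ≤ a) (hac : a ≤ c)
    (hw : IntervalIntegrable w volume a c) (hw1 : ∫ u in a..c, w u = 1) (hβ : ∀ u, |w u| ≤ β)
    (hS : AEStronglyMeasurable S (volume.restrict (Ioc a c))) (hη : 0 ≤ η) (hD : 0 ≤ D)
    (hr : 0 ≤ r) (hfar : ∀ u ∈ Ioc a c, r ≤ u → |S u - l| ≤ η)
    (hnear : ∀ u ∈ Ioc a c, u < r → |S u - l| ≤ D) :
    |(∫ u in a..c, w u * S u) - l| ≤ β * ((c - a) * η + D * r) := by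
  have hβ0 : 0 ≤ β := (abs_nonneg _).trans (hβ 0)
  have hbd : ∀ u ∈ Ioc a c, |S u - l| ≤ η + (Iio r).indicator (fun _ => D) u := by
    intro u hu
    by_cases hur : u < r
    · rw [indicator_of_mem (show u ∈ Iio r from hur)]
      linarith [hnear u hu hur]
    · rw [indicator_of_notMem (show u ∉ Iio r from hur), add_zero]
      exact hfar u hu (not_lt.mp hur)
  have hwS : IntervalIntegrable (fun u => w u * S u) volume a c := by
    rw [intervalIntegrable_iff_integrableOn_Ioc_of_le hac] at hw ⊢
    refine Integrable.mul_bdd (c := |l| + η + D) hw hS ?_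
    filter_upwards [ae_restrict_mem measurableSet_Ioc] with u hu
    have h1 : |S u - l| ≤ η + D := by
      rcases lt_or_ge u r with h | h
      · linarith [hnear u hu h]
      · linarith [hfar u hu h]
    rw [Real.norm_eq_abs]
    linarith [abs_sub_abs_le_abs_sub (S u) l]
  have heq : (∫ u in a..c, w u * S u) - l = ∫ u in a..c, w u * (S u - l) := by
    have : (fun u => w u * (S u - l)) = fun u => w u * S u - w u * l := by
      funext u; ring
    rw [this, intervalIntegral.integral_sub hwS (hw.mul_const l),
      intervalIntegral.integral_mul_const, hw1, one_mul]
  have hconst : IntegrableOn (fun _ : ℝ => η) (Ioc a c) volume :=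
    integrableOn_const measure_Ioc_lt_top.ne
  have hind : IntegrableOn ((Iio r).indicator fun _ => D) (Ioc a c) volume :=
    (integrableOn_const measure_Ioc_lt_top.ne).indicator measurableSet_Iio
  have hg : IntervalIntegrable (fun u => β * (η + (Iio r).indicator (fun _ => D) u))
      volume a c := by
    rw [intervalIntegrable_iff_integrableOn_Ioc_of_le hac]
    exact (hconst.add hind).const_mul β
  rw [heq]
  have h1 := intervalIntegral.norm_integral_le_of_norm_le (f := fun u => w u * (S u - l)) hac
    (Eventually.of_forall fun u hu => ?_) hg
  · refine h1.trans ?_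
    rw [intervalIntegral.integral_const_mul, intervalIntegral.integral_of_le hac,
      integral_add hconst hind, setIntegral_const,
      setIntegral_indicator measurableSet_Iio, setIntegral_const, smul_eq_mul, smul_eq_mul,
      Real.volume_real_Ioc_of_le hac, mul_comm _ D]
    gcongr
    calc volume.real (Ioc a c ∩ Iio r) ≤ volume.real (Ioc 0 r) :=
          measureReal_mono (fun u hu => ⟨ha.trans_lt hu.1.1, le_of_lt hu.2⟩)
            measure_Ioc_lt_top.ne
      _ = r := by rw [Real.volume_real_Ioc_of_le hr, sub_zero]
  · rw [Real.norm_eq_abs, abs_mul]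
    gcongr
    · exact hβ u
    · exact hbd u hu

/-! ### Sequences of events of vanishing probability -/

section Vanishing

variable {Ω : Type*} [MeasurableSpace Ω]

/-- The outer probability of `E n` tends to zero; the sets need not be measurable. -/
def Vanishing (P : Measure Ω) (E : ℕ → Set Ω) : Prop :=
  Tendsto (fun n => P (E n)) atTop (𝓝 0)

variable {P : Measure Ω} {E F : ℕ → Set Ω}

theorem Vanishing.mono (hF : Vanishing P F) (h : ∀ᶠ n in atTop, E n ⊆ F n) : Vanishing P E :=
  tendsto_of_tendsto_of_tendsto_of_le_of_le' tendsto_const_nhds hF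
    (Eventually.of_forall fun _ => zero_le) (h.mono fun _ hn => measure_mono hn)

theorem Vanishing.union (hE : Vanishing P E) (hF : Vanishing P F) :
    Vanishing P fun n => E n ∪ F n := by
  have h := Tendsto.add hE hF
  rw [add_zero] at h
  exact tendsto_of_tendsto_of_tendsto_of_le_of_le tendsto_const_nhds h (fun _ => zero_le)
    fun n => measure_union_le _ _

theorem Vanishing.biUnion {ι : Type*} (Q : Finset ι) {E : ι → ℕ → Set Ω}
    (h : ∀ q ∈ Q, Vanishing P (E q)) : Vanishing P fun n => ⋃ q ∈ Q, E q n := by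
  have h1 := tendsto_finsetSum Q h
  rw [Finset.sum_const_zero] at h1
  exact tendsto_of_tendsto_of_tendsto_of_le_of_le tendsto_const_nhds h1 (fun _ => zero_le)
    fun n => measure_biUnion_finset_le _ _

theorem Vanishing.of_null {N : Set Ω} (h : P N = 0) : Vanishing P fun _ => N := by
  simp [Vanishing, h]

end Vanishing

/-! ### Laws with a density -/

section Density

variable {f : ℝ → ℝ}

theorem densityLaw_singleton (f : ℝ → ℝ) (t : ℝ) : densityLaw f {t} = 0 :=
  withDensity_absolutelyContinuous _ _ (by simp)

theorem densityLaw_real_Ici [IsProbabilityMeasure (densityLaw f)] (t : ℝ) :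
    (densityLaw f).real (Ici t) = 1 - cdf (densityLaw f) t := by
  have h1 : (densityLaw f).real (Ici t) = (densityLaw f).real (Ioi t) := by
    refine measureReal_congr ?_
    have : NullSingletonClass (densityLaw f) := ⟨densityLaw_singleton f⟩
    exact Ioi_ae_eq_Ici.symm
  rw [h1, cdf_eq_real, ← compl_Iic, probReal_compl_eq_one_sub measurableSet_Iic]

theorem integrable_density [IsProbabilityMeasure (densityLaw f)] (hf : Measurable f)
    (h0 : ∀ t, 0 ≤ f t) : Integrable f := by
  refine ⟨hf.aestronglyMeasurable, ?_⟩
  have h : ∫⁻ t, ENNReal.ofReal (f t) = 1 := by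
    rw [← setLIntegral_univ, ← withDensity_apply _ MeasurableSet.univ]
    exact measure_univ (μ := densityLaw f)
  rw [hasFiniteIntegral_iff_ofReal (Eventually.of_forall h0), h]
  exact ENNReal.one_lt_top

theorem cdf_densityLaw_sub [IsProbabilityMeasure (densityLaw f)] (hf : Measurable f)
    (h0 : ∀ t, 0 ≤ f t) {s t : ℝ} (hst : s ≤ t) :
    cdf (densityLaw f) t - cdf (densityLaw f) s = ∫ x in s..t, f x := by
  have h1 : (densityLaw f).real (Ioc s t) = ∫ x in s..t, f x := by
    rw [measureReal_def, densityLaw, withDensity_apply _ measurableSet_Ioc,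
      ← ofReal_integral_eq_lintegral_ofReal (integrable_density hf h0).integrableOn
        (Eventually.of_forall h0), ENNReal.toReal_ofReal (integral_nonneg h0),
      intervalIntegral.integral_of_le hst]
  rw [← h1, cdf_eq_real, cdf_eq_real, ← Iic_sdiff_Iic,
    measureReal_sdiff (Iic_subset_Iic.mpr hst) measurableSet_Iic]

theorem continuous_cdf_densityLaw [IsProbabilityMeasure (densityLaw f)] (hf : Measurable f)
    (h0 : ∀ t, 0 ≤ f t) : Continuous (cdf (densityLaw f)) := by
  have h : ∀ t, cdf (densityLaw f) t = cdf (densityLaw f) 0 + ∫ x in (0 : ℝ)..t, f x := by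
    intro t
    rcases le_total 0 t with ht | ht
    · rw [← cdf_densityLaw_sub hf h0 ht]; ring
    · rw [intervalIntegral.integral_symm, ← cdf_densityLaw_sub hf h0 ht]; ring
  have h2 : (cdf (densityLaw f) : ℝ → ℝ) =
      fun t => cdf (densityLaw f) 0 + ∫ x in (0 : ℝ)..t, f x := funext h
  rw [h2]
  exact continuous_const.add (intervalIntegral.continuous_primitive
    (fun a b => (integrable_density hf h0).intervalIntegrable) 0)

theorem cdf_zero_of_ae_nonneg [IsProbabilityMeasure (densityLaw f)] {Ω : Type*}
    [MeasurableSpace Ω] {P : Measure Ω} {Z : Ω → ℝ} (hZ : Measurable Z)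
    (hlaw : P.map Z = densityLaw f) (h0 : ∀ᵐ ω ∂P, 0 ≤ Z ω) : cdf (densityLaw f) 0 = 0 := by
  have h : densityLaw f (Iio 0) = 0 := by
    rw [← hlaw, Measure.map_apply hZ measurableSet_Iio]
    rw [ae_iff] at h0
    simpa [Set.preimage] using h0
  have h2 : densityLaw f (Iic 0) = 0 := by
    rw [← Iio_union_right, measure_union_null h (densityLaw_singleton f 0)]
  rw [cdf_eq_real, measureReal_def, h2, ENNReal.toReal_zero]

theorem cdf_lt_one_of_lt_upperEndpoint {μ : Measure ℝ} {t : ℝ}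
    (h : (t : EReal) < upperEndpoint μ) : cdf μ t < 1 := by
  obtain ⟨s, hs⟩ := lt_iSup_iff.mp h
  obtain ⟨hs1, hs2⟩ := lt_iSup_iff.mp hs
  exact (monotone_cdf μ (EReal.coe_lt_coe_iff.mp hs2).le).trans_lt hs1

end Density

/-! ### Empirical means over a censored sample -/

section EmpMean

variable {Ω : Type*} {X C : ℕ → Ω → ℝ}

/-- The average of `φ (X i, C i)` over the first `n` observations. -/
def empMean (X C : ℕ → Ω → ℝ) (n : ℕ) (ω : Ω) (φ : ℝ × ℝ → ℝ) : ℝ :=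
  (∑ i ∈ Finset.range n, φ (X i ω, C i ω)) / n

theorem empMean_mono {n : ℕ} {ω : Ω} {φ φ' : ℝ × ℝ → ℝ} (h : ∀ z, φ z ≤ φ' z) :
    empMean X C n ω φ ≤ empMean X C n ω φ' := by
  unfold empMean
  gcongr
  exact h _

end EmpMean

/-- The common law of the pairs `(X i, C i)`. -/
def pairLaw (f g : ℝ → ℝ) : Measure (ℝ × ℝ) := (densityLaw f).prod (densityLaw g)

namespace IsCensoredSample

variable {Ω : Type*} [MeasurableSpace Ω] {P : Measure Ω} {X C : ℕ → Ω → ℝ} {f g : ℝ → ℝ}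

theorem measurable_pair (hs : IsCensoredSample P X C f g) (i : ℕ) :
    Measurable fun ω => (X i ω, C i ω) :=
  (hs.measurable_survival i).prodMk (hs.measurable_censoring i)

theorem ae_followUp_pos (hs : IsCensoredSample P X C f g) :
    ∀ᵐ ω ∂P, ∀ i, 0 < followUp X C i ω := by
  rw [ae_all_iff]
  intro i
  have key : ∀ {h : ℝ → ℝ} {Z : Ω → ℝ}, Measurable Z → P.map Z = densityLaw h →
      ∀ᵐ ω ∂P, Z ω ≠ 0 := by
    intro h Z hZ hlaw
    have := densityLaw_singleton h 0
    rw [← hlaw, Measure.map_apply hZ (measurableSet_singleton 0)] at this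
    rw [ae_iff]
    simpa [Set.preimage] using this
  filter_upwards [hs.survival_nonneg i, hs.censoring_nonneg i,
    key (hs.measurable_survival i) (hs.law_survival i),
    key (hs.measurable_censoring i) (hs.law_censoring i)] with ω h1 h2 h3 h4
  exact lt_min (lt_of_le_of_ne h1 h3.symm) (lt_of_le_of_ne h2 h4.symm)

variable [IsProbabilityMeasure P]

theorem isProbabilityMeasure_survival (hs : IsCensoredSample P X C f g) :
    IsProbabilityMeasure (densityLaw f) :=
  hs.law_survival 0 ▸ Measure.isProbabilityMeasure_map (hs.measurable_survival 0).aemeasurable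

theorem isProbabilityMeasure_censoring (hs : IsCensoredSample P X C f g) :
    IsProbabilityMeasure (densityLaw g) :=
  hs.law_censoring 0 ▸ Measure.isProbabilityMeasure_map (hs.measurable_censoring 0).aemeasurable

theorem isProbabilityMeasure_pairLaw (hs : IsCensoredSample P X C f g) :
    IsProbabilityMeasure (pairLaw f g) := by
  have := hs.isProbabilityMeasure_survival
  have := hs.isProbabilityMeasure_censoring
  unfold pairLaw
  infer_instance

theorem map_pair (hs : IsCensoredSample P X C f g) (i : ℕ) :
    P.map (fun ω => (X i ω, C i ω)) = pairLaw f g := by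
  rw [(indepFun_iff_map_prod_eq_prod_map_map (hs.measurable_survival i).aemeasurable
    (hs.measurable_censoring i).aemeasurable).mp (hs.indep_survival_censoring i),
    hs.law_survival, hs.law_censoring, pairLaw]

/-- Chebyshev's inequality for empirical means. -/
theorem measure_abs_empMean_sub_ge (hs : IsCensoredSample P X C f g) {φ : ℝ × ℝ → ℝ}
    (hφ : Measurable φ) {B : ℝ} (hB : ∀ z, |φ z| ≤ B) {n : ℕ} (hn : 0 < n) {η : ℝ} (hη : 0 < η) :
    P {ω | η ≤ |empMean X C n ω φ - ∫ z, φ z ∂pairLaw f g|} ≤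
      ENNReal.ofReal ((∫ z, φ z ^ 2 ∂pairLaw f g) / (n * η ^ 2)) := by
  set Y : ℕ → Ω → ℝ := fun i ω => φ (X i ω, C i ω) with hY
  have hn' : (0 : ℝ) < n := Nat.cast_pos.mpr hn
  have hYm : ∀ i, Measurable (Y i) := fun i => hφ.comp (hs.measurable_pair i)
  have hL : ∀ i, MemLp (Y i) 2 P := fun i =>
    MemLp.of_bound (hYm i).aestronglyMeasurable B (Eventually.of_forall fun ω => hB _)
  have hmean : ∀ i, ∫ ω, Y i ω ∂P = ∫ z, φ z ∂pairLaw f g := fun i => by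
    rw [← hs.map_pair i, integral_map (hs.measurable_pair i).aemeasurable
      hφ.aestronglyMeasurable]
  have hsq : ∀ i, ∫ ω, Y i ω ^ 2 ∂P = ∫ z, φ z ^ 2 ∂pairLaw f g := fun i => by
    rw [← hs.map_pair i, integral_map (hs.measurable_pair i).aemeasurable
      (hφ.pow_const 2).aestronglyMeasurable]
  have hind : ∀ i j, i ≠ j → IndepFun (Y i) (Y j) P := fun i j hij =>
    (hs.indep_pairs.indepFun hij).comp hφ hφ
  have hvar : variance (∑ i ∈ Finset.range n, Y i) P ≤ n * ∫ z, φ z ^ 2 ∂pairLaw f g := by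
    rw [IndepFun.variance_sum (fun i _ => hL i) fun i _ j _ hij => hind i j hij]
    calc ∑ i ∈ Finset.range n, variance (Y i) P
        ≤ ∑ i ∈ Finset.range n, ∫ z, φ z ^ 2 ∂pairLaw f g := by
          refine Finset.sum_le_sum fun i _ => ?_
          rw [← hsq i]
          exact variance_le_expectation_sq (hYm i).aestronglyMeasurable
      _ = _ := by rw [Finset.sum_const, Finset.card_range, nsmul_eq_mul]
  have hsum : ∫ ω, (∑ i ∈ Finset.range n, Y i) ω ∂P = n * ∫ z, φ z ∂pairLaw f g := by
    simp only [Finset.sum_apply]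
    rw [integral_finsetSum _ fun i _ => (hL i).integrable one_le_two]
    simp only [hmean, Finset.sum_const, Finset.card_range, nsmul_eq_mul]
  have hcheb := meas_ge_le_variance_div_sq (memLp_finsetSum' (Finset.range n) fun i _ => hL i)
    (show 0 < n * η by positivity) (μ := P)
  rw [hsum] at hcheb
  have hset : {ω | η ≤ |empMean X C n ω φ - ∫ z, φ z ∂pairLaw f g|} ⊆
      {ω | n * η ≤ |(∑ i ∈ Finset.range n, Y i) ω - n * ∫ z, φ z ∂pairLaw f g|} := by
    intro ω hω
    change η ≤ |empMean X C n ω φ - ∫ z, φ z ∂pairLaw f g| at hω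
    change n * η ≤ |(∑ i ∈ Finset.range n, Y i) ω - n * ∫ z, φ z ∂pairLaw f g|
    rw [Finset.sum_apply]
    have : ∑ i ∈ Finset.range n, Y i ω - n * ∫ z, φ z ∂pairLaw f g =
        n * (empMean X C n ω φ - ∫ z, φ z ∂pairLaw f g) := by
      rw [empMean]; field_simp; rfl
    rw [this, abs_mul, abs_of_pos hn']
    gcongr
  refine (measure_mono hset).trans (hcheb.trans (ENNReal.ofReal_le_ofReal ?_))
  rw [div_le_div_iff₀ (by positivity) (by positivity)]
  calc _ ≤ (n * ∫ z, φ z ^ 2 ∂pairLaw f g) * (n * η ^ 2) := by gcongr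
    _ = _ := by ring

/-- The weak law of large numbers for empirical means. -/
theorem vanishing_empMean (hs : IsCensoredSample P X C f g) {φ : ℝ × ℝ → ℝ}
    (hφ : Measurable φ) {B : ℝ} (hB : ∀ z, |φ z| ≤ B) {η : ℝ} (hη : 0 < η) :
    Vanishing P fun n => {ω | η ≤ |empMean X C n ω φ - ∫ z, φ z ∂pairLaw f g|} := by
  have h1 : Tendsto (fun n : ℕ => ENNReal.ofReal
      ((∫ z, φ z ^ 2 ∂pairLaw f g) / (n * η ^ 2))) atTop (𝓝 0) := by
    rw [← ENNReal.ofReal_zero]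
    refine ENNReal.tendsto_ofReal (Tendsto.const_div_atTop ?_ _)
    exact tendsto_natCast_atTop_atTop.atTop_mul_const (by positivity)
  refine tendsto_of_tendsto_of_tendsto_of_le_of_le' tendsto_const_nhds h1
    (Eventually.of_forall fun _ => zero_le) ?_
  filter_upwards [eventually_gt_atTop 0] with n hn
  exact hs.measure_abs_empMean_sub_ge hφ hB hn hη

/-! ### The distribution of the observations -/

theorem cdf_survival_zero (hs : IsCensoredSample P X C f g) : cdf (densityLaw f) 0 = 0 := by
  have := hs.isProbabilityMeasure_survival
  exact cdf_zero_of_ae_nonneg (hs.measurable_survival 0) (hs.law_survival 0)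
    (hs.survival_nonneg 0)

theorem cdf_censoring_zero (hs : IsCensoredSample P X C f g) : cdf (densityLaw g) 0 = 0 := by
  have := hs.isProbabilityMeasure_censoring
  exact cdf_zero_of_ae_nonneg (hs.measurable_censoring 0) (hs.law_censoring 0)
    (hs.censoring_nonneg 0)

theorem density_eq_zero_of_neg (hs : IsCensoredSample P X C f g) :
    ∀ᵐ t, t < 0 → f t = 0 := by
  have := hs.isProbabilityMeasure_survival
  have h : densityLaw f (Iio 0) = 0 := by
    refine measure_mono_null Iio_subset_Iic_self ?_
    rw [← ofReal_cdf, hs.cdf_survival_zero, ENNReal.ofReal_zero]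
  rw [densityLaw, withDensity_apply _ measurableSet_Iio,
    lintegral_eq_zero_iff hs.measurable_f.ennreal_ofReal,
    Filter.EventuallyEq, ae_restrict_iff' measurableSet_Iio] at h
  filter_upwards [h] with t ht ht0
  have := ht ht0
  simp only [Pi.zero_apply, ENNReal.ofReal_eq_zero] at this
  exact le_antisymm this (hs.f_nonneg t)

end IsCensoredSample

/-! ### Elementary properties of the Nelson-Aalen estimator -/

section NelsonAalen

variable {Ω : Type*} (X C : ℕ → Ω → ℝ) (n : ℕ) (ω : Ω)

/-- The indicator of `{t ≤ min X C}`, as a function of the pair `(X, C)`. -/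
def atRiskInd (t : ℝ) : ℝ × ℝ → ℝ := (Ici t ×ˢ Ici t).indicator 1

/-- The indicator of `{min X C ≤ t, X ≤ C}`, as a function of the pair `(X, C)`. -/
def deathInd (t : ℝ) : ℝ × ℝ → ℝ := {z | z.1 ≤ t ∧ z.1 ≤ z.2}.indicator 1

theorem atRiskInd_apply (t : ℝ) (i : ℕ) :
    atRiskInd t (X i ω, C i ω) = if t ≤ followUp X C i ω then 1 else 0 := by
  simp [atRiskInd, indicator_apply, followUp]

theorem deathInd_apply (t : ℝ) (i : ℕ) :
    deathInd t (X i ω, C i ω) = if followUp X C i ω ≤ t then censInd X C i ω else 0 := by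
  simp only [deathInd, indicator_apply, followUp, censInd, Pi.one_apply]
  change (if X i ω ≤ t ∧ X i ω ≤ C i ω then (1 : ℝ) else 0) = _
  by_cases h : X i ω ≤ C i ω
  · simp [h]
  · simp [h]

theorem abs_atRiskInd_le (t : ℝ) (z : ℝ × ℝ) : |atRiskInd t z| ≤ 1 := by
  rw [atRiskInd, indicator_apply]
  split_ifs <;> simp

theorem abs_deathInd_le (t : ℝ) (z : ℝ × ℝ) : |deathInd t z| ≤ 1 := by
  rw [deathInd, indicator_apply]
  split_ifs <;> simp

theorem deathInd_nonneg (t : ℝ) (z : ℝ × ℝ) : 0 ≤ deathInd t z :=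
  indicator_nonneg (fun _ _ => zero_le_one) z

theorem deathInd_mono {s t : ℝ} (hst : s ≤ t) (z : ℝ × ℝ) : deathInd s z ≤ deathInd t z :=
  have h : {w : ℝ × ℝ | w.1 ≤ s ∧ w.1 ≤ w.2} ⊆ {w | w.1 ≤ t ∧ w.1 ≤ w.2} :=
    fun _ hw => ⟨hw.1.trans hst, hw.2⟩
  indicator_le_indicator_of_subset h (fun _ => zero_le_one) z

theorem atRiskInd_anti {s t : ℝ} (hst : s ≤ t) (z : ℝ × ℝ) : atRiskInd t z ≤ atRiskInd s z :=
  indicator_le_indicator_of_subset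
    (prod_mono (Ici_subset_Ici.mpr hst) (Ici_subset_Ici.mpr hst)) (fun _ => zero_le_one) z

theorem measurable_atRiskInd (t : ℝ) : Measurable (atRiskInd t) :=
  measurable_one.indicator (measurableSet_Ici.prod measurableSet_Ici)

theorem measurableSet_death (t : ℝ) : MeasurableSet {z : ℝ × ℝ | z.1 ≤ t ∧ z.1 ≤ z.2} :=
  (measurableSet_le measurable_fst measurable_const).inter
    (measurableSet_le measurable_fst measurable_snd)

theorem measurable_deathInd (t : ℝ) : Measurable (deathInd t) :=
  measurable_one.indicator (measurableSet_death t)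

/-- The Nelson-Aalen estimator in terms of the fraction of subjects at risk. -/
theorem nelsonAalen_eq (t : ℝ) :
    nelsonAalen X C n ω t = (∑ i ∈ Finset.range n, deathInd t (X i ω, C i ω) /
      empMean X C n ω (atRiskInd (followUp X C i ω))) / n := by
  rw [nelsonAalen, Finset.sum_div]
  refine Finset.sum_congr rfl fun i hi => ?_
  have hn : (n : ℝ) ≠ 0 := by
    have := Finset.mem_range.mp hi
    exact Nat.cast_ne_zero.mpr (by omega)
  simp only [empMean, atRiskInd_apply, deathInd_apply]
  rw [div_div_eq_mul_div, mul_div_right_comm, mul_div_cancel_right₀ _ hn]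

theorem monotone_nelsonAalen : Monotone (nelsonAalen X C n ω) := by
  intro s t hst
  rw [nelsonAalen_eq, nelsonAalen_eq]
  gcongr
  · refine div_nonneg (Finset.sum_nonneg fun j _ => ?_) (Nat.cast_nonneg n)
    exact indicator_nonneg (fun _ _ => zero_le_one) _
  · exact deathInd_mono hst _

theorem nelsonAalen_nonneg (t : ℝ) : 0 ≤ nelsonAalen X C n ω t := by
  rw [nelsonAalen_eq]
  refine div_nonneg (Finset.sum_nonneg fun i _ => div_nonneg (deathInd_nonneg _ _) ?_)
    (Nat.cast_nonneg n)
  exact div_nonneg (Finset.sum_nonneg fun j _ => indicator_nonneg (fun _ _ => zero_le_one) _)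
    (Nat.cast_nonneg n)

variable {X C n ω}

theorem nelsonAalen_zero (h : ∀ i, 0 < followUp X C i ω) : nelsonAalen X C n ω 0 = 0 := by
  rw [nelsonAalen]
  refine Finset.sum_eq_zero fun i _ => ?_
  rw [if_neg (not_le.mpr (h i)), zero_div]

/-- Since at most all subjects are at risk, the Nelson-Aalen estimator dominates the empirical
subdistribution function of the uncensored observations. -/
theorem empMean_deathInd_le_nelsonAalen (t : ℝ) :
    empMean X C n ω (deathInd t) ≤ nelsonAalen X C n ω t := by
  rw [nelsonAalen_eq, empMean]
  gcongr with i hi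
  have hi' := Finset.mem_range.mp hi
  have hn : (0 : ℝ) < n := Nat.cast_pos.mpr (by omega)
  have hle : empMean X C n ω (atRiskInd (followUp X C i ω)) ≤ 1 := by
    rw [empMean, div_le_one hn]
    calc _ ≤ ∑ j ∈ Finset.range n, (1 : ℝ) :=
          Finset.sum_le_sum fun j _ => (le_abs_self _).trans (abs_atRiskInd_le _ _)
      _ = n := by simp
  have hpos : 0 < empMean X C n ω (atRiskInd (followUp X C i ω)) := by
    refine div_pos (Finset.sum_pos' (fun j _ => indicator_nonneg (fun _ _ => zero_le_one) _)
      ⟨i, hi, ?_⟩) hn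
    rw [atRiskInd_apply, if_pos le_rfl]
    exact one_pos
  exact le_div_self (deathInd_nonneg _ _) hpos hle

/-- If the fraction of subjects at risk is uniformly close to `y` on `[0, t]`, the Nelson-Aalen
estimator is close to the empirical mean of `1_{T ≤ t} Δ / y(T)`. -/
theorem abs_nelsonAalen_sub_le (hT : ∀ i, 0 < followUp X C i ω) {t y₀ η : ℝ} {y : ℝ → ℝ}
    (hy₀ : 0 < y₀) (hy : ∀ s ∈ Icc 0 t, y₀ ≤ y s) (hη : η ≤ y₀ / 2)
    (hη0 : 0 ≤ η) (hclose : ∀ s ∈ Icc 0 t, |empMean X C n ω (atRiskInd s) - y s| ≤ η) :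
    |nelsonAalen X C n ω t - empMean X C n ω (fun z => deathInd t z / y z.1)| ≤
      2 * η / y₀ ^ 2 := by
  rw [nelsonAalen_eq, empMean, ← sub_div, ← Finset.sum_sub_distrib, abs_div, Nat.abs_cast]
  refine div_le_of_le_mul₀ (Nat.cast_nonneg n) (by positivity) ?_
  refine (Finset.abs_sum_le_sum_abs _ _).trans ?_
  have : ∑ i ∈ Finset.range n, 2 * η / y₀ ^ 2 = 2 * η / y₀ ^ 2 * n := by
    rw [Finset.sum_const, Finset.card_range, nsmul_eq_mul, mul_comm]
  rw [← this]
  refine Finset.sum_le_sum fun i _ => ?_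
  by_cases hi : X i ω ≤ t ∧ X i ω ≤ C i ω
  · have h1 : deathInd t (X i ω, C i ω) = 1 := by
      rw [deathInd_apply, if_pos (show followUp X C i ω ≤ t from (min_le_left _ _).trans hi.1),
        censInd, if_pos hi.2]
    have h2 : followUp X C i ω = X i ω := min_eq_left hi.2
    have hmem : X i ω ∈ Icc 0 t := ⟨by have := hT i; rw [h2] at this; exact this.le, hi.1⟩
    rw [h1, h2]
    have h3 := hy _ hmem
    have h4 := hclose _ hmem
    have h5 := (abs_le.mp h4).1
    set Y := empMean X C n ω (atRiskInd (X i ω))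
    have hY : y₀ / 2 ≤ Y := by linarith
    have hYpos : 0 < Y := by linarith
    have hypos : 0 < y (X i ω) := by linarith
    rw [div_sub_div _ _ hYpos.ne' hypos.ne', one_mul, mul_one, abs_div,
      abs_of_pos (mul_pos hYpos hypos), abs_sub_comm, div_le_div_iff₀ (by positivity)
      (by positivity)]
    have h6 : y₀ / 2 * y₀ ≤ Y * y (X i ω) := by gcongr
    calc |Y - y (X i ω)| * y₀ ^ 2 ≤ η * y₀ ^ 2 := by gcongr
      _ = 2 * η * (y₀ / 2 * y₀) := by ring
      _ ≤ 2 * η * (Y * y (X i ω)) := by gcongr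
  · have h1 : deathInd t (X i ω, C i ω) = 0 :=
      indicator_of_notMem (s := {z : ℝ × ℝ | z.1 ≤ t ∧ z.1 ≤ z.2}) hi _
    rw [h1, zero_div, zero_div, sub_zero, abs_zero]
    positivity

end NelsonAalen

/-! ### Consistency of the Nelson-Aalen estimator -/

/-- The probability `P(T ≥ s) = P(X ≥ s) P(C ≥ s)` of being at risk at time `s`. -/
def atRiskProb (f g : ℝ → ℝ) (s : ℝ) : ℝ :=
  (densityLaw f).real (Ici s) * (densityLaw g).real (Ici s)

namespace IsCensoredSample

variable {Ω : Type*} [MeasurableSpace Ω] {P : Measure Ω} [IsProbabilityMeasure P]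
  {X C : ℕ → Ω → ℝ} {f g : ℝ → ℝ}

theorem antitone_atRiskProb (hs : IsCensoredSample P X C f g) : Antitone (atRiskProb f g) := by
  have := hs.isProbabilityMeasure_survival
  have := hs.isProbabilityMeasure_censoring
  intro s t hst
  unfold atRiskProb
  have h1 := measureReal_mono (μ := densityLaw f) (Ici_subset_Ici.mpr hst)
  have h2 := measureReal_mono (μ := densityLaw g) (Ici_subset_Ici.mpr hst)
  gcongr

theorem continuous_atRiskProb (hs : IsCensoredSample P X C f g) :
    Continuous (atRiskProb f g) := by
  have := hs.isProbabilityMeasure_survival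
  have := hs.isProbabilityMeasure_censoring
  have h1 := continuous_cdf_densityLaw hs.measurable_f hs.f_nonneg
  have h2 := continuous_cdf_densityLaw hs.measurable_g hs.g_nonneg
  have : atRiskProb f g = fun s => (1 - cdf (densityLaw f) s) * (1 - cdf (densityLaw g) s) := by
    funext s
    rw [atRiskProb, densityLaw_real_Ici, densityLaw_real_Ici]
  rw [this]
  exact (continuous_const.sub h1).mul (continuous_const.sub h2)

theorem atRiskProb_zero (hs : IsCensoredSample P X C f g) : atRiskProb f g 0 = 1 := by
  have := hs.isProbabilityMeasure_survival
  have := hs.isProbabilityMeasure_censoring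
  rw [atRiskProb, densityLaw_real_Ici, densityLaw_real_Ici, hs.cdf_survival_zero,
    hs.cdf_censoring_zero]
  norm_num

theorem atRiskProb_pos (hs : IsCensoredSample P X C f g) {t : ℝ}
    (hF : cdf (densityLaw f) t < 1) (hG : cdf (densityLaw g) t < 1) : 0 < atRiskProb f g t := by
  have := hs.isProbabilityMeasure_survival
  have := hs.isProbabilityMeasure_censoring
  rw [atRiskProb, densityLaw_real_Ici, densityLaw_real_Ici]
  exact mul_pos (by linarith) (by linarith)

theorem abs_deathInd_div_le (hs : IsCensoredSample P X C f g) {t : ℝ}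
    (ht : 0 < atRiskProb f g t) (z : ℝ × ℝ) :
    |deathInd t z / atRiskProb f g z.1| ≤ 1 / atRiskProb f g t := by
  rw [deathInd]
  by_cases hz : z ∈ {z : ℝ × ℝ | z.1 ≤ t ∧ z.1 ≤ z.2}
  · have h := hs.antitone_atRiskProb hz.1
    rw [indicator_of_mem hz, Pi.one_apply, abs_of_pos (one_div_pos.mpr (ht.trans_le h))]
    exact one_div_le_one_div_of_le ht h
  · rw [indicator_of_notMem hz, zero_div, abs_zero]
    positivity

theorem integral_atRiskInd (hs : IsCensoredSample P X C f g) (s : ℝ) :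
    ∫ z, atRiskInd s z ∂pairLaw f g = atRiskProb f g s := by
  have := hs.isProbabilityMeasure_censoring
  rw [atRiskInd, integral_indicator_one (measurableSet_Ici.prod measurableSet_Ici), pairLaw,
    measureReal_prod_prod, atRiskProb]

/-- The expectation of `1_{T ≤ t} Δ / P(T ≥ s)|_{s = T}` is the cumulative hazard at `t`: the
censoring distribution cancels. -/
theorem integral_deathInd_div (hs : IsCensoredSample P X C f g) {t : ℝ} (ht : 0 ≤ t)
    (hF : cdf (densityLaw f) t < 1) (hG : cdf (densityLaw g) t < 1) :
    ∫ z, deathInd t z / atRiskProb f g z.1 ∂pairLaw f g = ∫ s in (0 : ℝ)..t, hazard f s := by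
  have := hs.isProbabilityMeasure_survival
  have := hs.isProbabilityMeasure_censoring
  have hpl := hs.isProbabilityMeasure_pairLaw
  have hy := hs.atRiskProb_pos hF hG
  have hm : Measurable fun z : ℝ × ℝ => deathInd t z / atRiskProb f g z.1 :=
    (measurable_deathInd t).div (hs.antitone_atRiskProb.measurable.comp measurable_fst)
  have hint : Integrable (fun z : ℝ × ℝ => deathInd t z / atRiskProb f g z.1) (pairLaw f g) :=
    Integrable.of_bound hm.aestronglyMeasurable _
      (Eventually.of_forall fun z => hs.abs_deathInd_div_le hy z)
  rw [pairLaw] at hint ⊢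
  rw [integral_prod _ hint]
  have hinner : ∀ x, ∫ c, deathInd t (x, c) / atRiskProb f g x ∂densityLaw g =
      (Iic t).indicator (fun x => 1 / (1 - cdf (densityLaw f) x)) x := by
    intro x
    by_cases hx : x ≤ t
    · rw [indicator_of_mem (show x ∈ Iic t from hx)]
      have h1 : (fun c => deathInd t (x, c) / atRiskProb f g x) =
          fun c => (Ici x).indicator 1 c / atRiskProb f g x := by
        funext c
        congr 1
        simp [deathInd, indicator_apply, hx]
      have h2 := (monotone_cdf (densityLaw f) hx).trans_lt hF
      have h3 := (monotone_cdf (densityLaw g) hx).trans_lt hG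
      rw [h1, integral_div, integral_indicator_one measurableSet_Ici, atRiskProb,
        densityLaw_real_Ici, densityLaw_real_Ici]
      have h4 : 1 - cdf (densityLaw g) x ≠ 0 := by linarith
      have h5 : 1 - cdf (densityLaw f) x ≠ 0 := by linarith
      field_simp
    · rw [indicator_of_notMem (show x ∉ Iic t from hx)]
      have h1 : (fun c => deathInd t (x, c) / atRiskProb f g x) = fun _ => 0 := by
        funext c
        simp [deathInd, hx]
      rw [h1, integral_zero]
  simp only [hinner]
  rw [densityLaw, integral_withDensity_eq_integral_toReal_smul hs.measurable_f.ennreal_ofReal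
    (Eventually.of_forall fun _ => ENNReal.ofReal_lt_top), intervalIntegral.integral_of_le ht,
    ← integral_indicator measurableSet_Ioc]
  refine integral_congr_ae ?_
  filter_upwards [hs.density_eq_zero_of_neg, Measure.ae_ne volume (0 : ℝ)] with x hx hx0
  rw [ENNReal.toReal_ofReal (hs.f_nonneg x), smul_eq_mul]
  rcases lt_or_gt_of_ne hx0 with h | h
  · rw [hx h, zero_mul, indicator_of_notMem fun h' => (h.trans h'.1).false]
  · simp only [indicator_apply, mem_Iic, mem_Ioc, h, true_and]
    split_ifs
    · rw [hazard, densityLaw]; ring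
    · rw [mul_zero]

/-- The Nelson-Aalen estimator is consistent at every point before the end of the supports. -/
theorem vanishing_nelsonAalen (hs : IsCensoredSample P X C f g) {t : ℝ} (ht : 0 ≤ t)
    (hF : cdf (densityLaw f) t < 1) (hG : cdf (densityLaw g) t < 1) {η : ℝ} (hη : 0 < η) :
    Vanishing P fun n =>
      {ω | η ≤ |nelsonAalen X C n ω t - ∫ s in (0 : ℝ)..t, hazard f s|} := by
  set y := atRiskProb f g with hydef
  have hy₀ : 0 < y t := hs.atRiskProb_pos hF hG
  set κ := min (y t / 2) (η * y t ^ 2 / 8) with hκdef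
  have hκ : 0 < κ := lt_min (by positivity) (by positivity)
  obtain ⟨Q, -, hQ⟩ := exists_finset_of_continuousOn ht
    (hs.continuous_atRiskProb.neg.continuousOn (s := Icc 0 t)) (half_pos hκ)
  have hv1 := hs.vanishing_empMean (φ := fun z => deathInd t z / y z.1)
    ((measurable_deathInd t).div (hs.antitone_atRiskProb.measurable.comp measurable_fst))
    (hs.abs_deathInd_div_le hy₀) (half_pos hη)
  rw [hs.integral_deathInd_div ht hF hG] at hv1
  have hv2 := Vanishing.biUnion (P := P) Q fun q _ =>
    hs.vanishing_empMean (measurable_atRiskInd q) (abs_atRiskInd_le q) (half_pos hκ)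
  have hv3 := Vanishing.of_null (P := P) (ae_iff.mp hs.ae_followUp_pos)
  refine ((hv1.union hv2).union hv3).mono (Eventually.of_forall fun n ω hω => ?_)
  by_contra hcon
  simp only [mem_union, not_or] at hcon
  obtain ⟨⟨h1, h2⟩, h3⟩ := hcon
  have h1 : |empMean X C n ω (fun z => deathInd t z / y z.1) - ∫ s in (0 : ℝ)..t, hazard f s| <
      η / 2 := not_le.mp h1
  have h3 : ∀ i, 0 < followUp X C i ω := not_not.mp h3
  have h2 : ∀ q ∈ Q, |empMean X C n ω (atRiskInd q) - y q| < κ / 2 := by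
    intro q hq
    by_contra h
    refine h2 (mem_biUnion (show q ∈ (Q : Set ℝ) from hq) ?_)
    change κ / 2 ≤ |_ - ∫ z, atRiskInd q z ∂pairLaw f g|
    rw [hs.integral_atRiskInd]
    exact not_lt.mp h
  have h4 : ∀ s ∈ Icc 0 t, |empMean X C n ω (atRiskInd s) - y s| ≤ κ := by
    intro s hst
    have := hQ (fun s => -empMean X C n ω (atRiskInd s))
      (fun a _ b _ hab => neg_le_neg (empMean_mono fun z => atRiskInd_anti hab z))
      (fun q hq => by
        rw [Pi.neg_apply, neg_sub_neg, abs_sub_comm]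
        exact (h2 q hq).le) s hst
    rw [Pi.neg_apply, neg_sub_neg, abs_sub_comm] at this
    linarith
  have h5 := abs_nelsonAalen_sub_le h3 hy₀ (fun s hst => hs.antitone_atRiskProb hst.2)
    (min_le_left _ _) hκ.le h4
  have h6 : 2 * κ / y t ^ 2 ≤ η / 4 := by
    rw [div_le_iff₀ (by positivity)]
    linarith [min_le_right (y t / 2) (η * y t ^ 2 / 8)]
  have h7 : η ≤ |nelsonAalen X C n ω t - ∫ s in (0 : ℝ)..t, hazard f s| := hω
  have h8 := abs_sub_le (nelsonAalen X C n ω t)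
    (empMean X C n ω (fun z => deathInd t z / y z.1)) (∫ s in (0 : ℝ)..t, hazard f s)
  linarith

end IsCensoredSample

/-! ### The Nelson-Aalen estimator near the origin -/

theorem density_eq_hazard_mul {f : ℝ → ℝ} {t : ℝ} (hF : cdf (densityLaw f) t < 1) :
    f t = hazard f t * (1 - cdf (densityLaw f) t) := by
  have : 1 - cdf (densityLaw f) t ≠ 0 := by linarith
  rw [hazard, div_mul_cancel₀ _ this]

namespace IsCensoredSample

variable {Ω : Type*} [MeasurableSpace Ω] {P : Measure Ω} {X C : ℕ → Ω → ℝ} {f g : ℝ → ℝ}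

theorem hazard_nonneg (hs : IsCensoredSample P X C f g) (t : ℝ) : 0 ≤ hazard f t :=
  div_nonneg (hs.f_nonneg t) (sub_nonneg.mpr (cdf_le_one _ t))

variable [IsProbabilityMeasure P]

theorem cdf_survival_eq_integral (hs : IsCensoredSample P X C f g) {t : ℝ} (ht : 0 ≤ t) :
    cdf (densityLaw f) t = ∫ x in (0 : ℝ)..t, f x := by
  have := hs.isProbabilityMeasure_survival
  rw [← cdf_densityLaw_sub hs.measurable_f hs.f_nonneg ht, hs.cdf_survival_zero, sub_zero]

theorem cdf_survival_le (hs : IsCensoredSample P X C f g) {t L : ℝ} (ht : 0 ≤ t)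
    (hF : cdf (densityLaw f) t < 1) (hL : ∀ x ∈ Icc 0 t, hazard f x ≤ L) :
    cdf (densityLaw f) t ≤ L * t := by
  have := hs.isProbabilityMeasure_survival
  have h := intervalIntegral.integral_mono_on ht
    (integrable_density hs.measurable_f hs.f_nonneg).intervalIntegrable
    (intervalIntegrable_const (c := L)) fun x hx => by
      rw [density_eq_hazard_mul ((monotone_cdf (densityLaw f) hx.2).trans_lt hF)]
      refine (mul_le_of_le_one_right (hs.hazard_nonneg x) ?_).trans (hL x hx)
      linarith [cdf_nonneg (densityLaw f) x]
  rw [intervalIntegral.integral_const, smul_eq_mul, sub_zero, mul_comm] at h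
  rwa [hs.cdf_survival_eq_integral ht]

theorem le_cdf_survival (hs : IsCensoredSample P X C f g) {t δ m : ℝ} (ht : 0 ≤ t) (htδ : t ≤ δ)
    (hF : cdf (densityLaw f) δ < 1) (hm : ∀ x ∈ Icc 0 t, m ≤ hazard f x) :
    m * (1 - cdf (densityLaw f) δ) * t ≤ cdf (densityLaw f) t := by
  have := hs.isProbabilityMeasure_survival
  have h := intervalIntegral.integral_mono_on ht
    (intervalIntegrable_const (c := m * (1 - cdf (densityLaw f) δ)))
    (integrable_density hs.measurable_f hs.f_nonneg).intervalIntegrable fun x hx => by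
      have h1 := monotone_cdf (densityLaw f) (hx.2.trans htδ)
      rw [density_eq_hazard_mul (h1.trans_lt hF)]
      refine mul_le_mul (hm x hx) ?_ ?_ (hs.hazard_nonneg x) <;> linarith
  rw [intervalIntegral.integral_const, smul_eq_mul, sub_zero, mul_comm] at h
  rwa [hs.cdf_survival_eq_integral ht]

theorem integral_deathInd_le (hs : IsCensoredSample P X C f g) (t : ℝ) :
    ∫ z, deathInd t z ∂pairLaw f g ≤ cdf (densityLaw f) t := by
  have := hs.isProbabilityMeasure_survival
  have := hs.isProbabilityMeasure_censoring
  have := hs.isProbabilityMeasure_pairLaw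
  rw [deathInd, integral_indicator_one (measurableSet_death t), cdf_eq_real]
  calc (pairLaw f g).real {z | z.1 ≤ t ∧ z.1 ≤ z.2} ≤ (pairLaw f g).real (Iic t ×ˢ univ) :=
        measureReal_mono fun z hz => ⟨hz.1, trivial⟩
    _ = (densityLaw f).real (Iic t) := by
        rw [pairLaw, measureReal_prod_prod, probReal_univ, mul_one]

theorem le_integral_deathInd (hs : IsCensoredSample P X C f g) {t δ : ℝ} (htδ : t ≤ δ) :
    cdf (densityLaw f) t * (1 - cdf (densityLaw g) δ) ≤ ∫ z, deathInd t z ∂pairLaw f g := by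
  have := hs.isProbabilityMeasure_survival
  have := hs.isProbabilityMeasure_censoring
  have := hs.isProbabilityMeasure_pairLaw
  rw [deathInd, integral_indicator_one (measurableSet_death t), cdf_eq_real,
    ← densityLaw_real_Ici, ← measureReal_prod_prod]
  exact measureReal_mono fun z hz => ⟨hz.1, hz.1.trans (htδ.trans hz.2)⟩

/-- Near the origin the Nelson-Aalen estimator exceeds a line of slope almost `λ(0)`, up to an
error that is small compared with any `r n` of larger order than `n ^ (-1/2)`. As the variance of
the fraction of deaths in `[0, t]` is `O(t / n)`, Chebyshev's inequality on a grid with a step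
proportional to `r n` suffices. -/
theorem exists_vanishing_nelsonAalen_lt (hs : IsCensoredSample P X C f g) {τ : ℝ} (hτ : 0 < τ)
    (hF : ∀ t < τ, cdf (densityLaw f) t < 1) (hG : ∀ t < τ, cdf (densityLaw g) t < 1)
    (hmono : MonotoneOn (hazard f) (Ico 0 τ)) {L : ℝ} (hL0 : 0 < L)
    (hL : ∀ t ∈ Ico 0 τ, hazard f t ≤ L) {η : ℝ} (hη : 0 < η) :
    ∃ δ₀, 0 < δ₀ ∧ ∀ δ, 0 < δ → δ ≤ δ₀ → ∀ r : ℕ → ℝ, (∀ᶠ n in atTop, 0 < r n) →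
      Tendsto (fun n : ℕ => n * r n ^ 2) atTop atTop →
      Vanishing P fun n => {ω | ∃ t ∈ Icc 0 δ,
        nelsonAalen X C n ω t < (hazard f 0 - η) * t - η * r n} := by
  have := hs.isProbabilityMeasure_survival
  have := hs.isProbabilityMeasure_censoring
  set m := hazard f 0 with hmdef
  have hm0 : 0 ≤ m := hs.hazard_nonneg 0
  have hcont : Tendsto (fun s => m * atRiskProb f g s) (𝓝[>] 0) (𝓝 (m * 1)) := by
    rw [← hs.atRiskProb_zero]
    exact ((continuous_const.mul hs.continuous_atRiskProb).tendsto 0).mono_left nhdsWithin_le_nhds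
  have hev := hcont.eventually_const_lt (show m - η / 2 < m * 1 by linarith)
  obtain ⟨δ₀, hδ₀, hδ₀τ, hδ₀pos⟩ := (hev.and
    ((eventually_nhdsWithin_of_eventually_nhds (eventually_lt_nhds hτ)).and
      self_mem_nhdsWithin)).exists
  have hδ₀pos : 0 < δ₀ := hδ₀pos
  refine ⟨δ₀, hδ₀pos, fun δ hδ hδδ₀ r hr hnr => ?_⟩
  have hlow : ∀ t ∈ Icc 0 δ, (m - η / 2) * t ≤ ∫ z, deathInd t z ∂pairLaw f g := by
    intro t ht
    have htδ₀ := ht.2.trans hδδ₀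
    have h1 := hs.le_integral_deathInd htδ₀
    have h2 := hs.le_cdf_survival ht.1 htδ₀ (hF δ₀ hδ₀τ) (m := m) fun x hx =>
      hmono ⟨le_rfl, hτ⟩ ⟨hx.1, by linarith [hx.2]⟩ hx.1
    have h3 : 0 ≤ 1 - cdf (densityLaw g) δ₀ := by linarith [hG δ₀ hδ₀τ]
    rw [atRiskProb, densityLaw_real_Ici, densityLaw_real_Ici] at hδ₀
    calc (m - η / 2) * t
        ≤ m * ((1 - cdf (densityLaw f) δ₀) * (1 - cdf (densityLaw g) δ₀)) * t :=
          mul_le_mul_of_nonneg_right hδ₀.le ht.1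
      _ = m * (1 - cdf (densityLaw f) δ₀) * t * (1 - cdf (densityLaw g) δ₀) := by ring
      _ ≤ _ := (mul_le_mul_of_nonneg_right h2 h3).trans h1
  have hup : ∀ t ∈ Icc 0 δ, ∫ z, deathInd t z ^ 2 ∂pairLaw f g ≤ L * t := by
    intro t ht
    have hsq : ∀ z, deathInd t z ^ 2 = deathInd t z := fun z => by
      rw [deathInd, indicator_apply]
      split_ifs <;> simp
    simp only [hsq]
    exact (hs.integral_deathInd_le t).trans (hs.cdf_survival_le ht.1 (hF t (by linarith [ht.2]))
      fun x hx => hL x ⟨hx.1, by linarith [hx.2, ht.2]⟩)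
  -- The step is chosen so that the line rises by at most `η * r n` between grid points.
  set step : ℕ → ℝ := fun n => η * r n / (m + 1) with hstep
  have hm1 : 0 < m + 1 := by linarith
  set bad : ℕ → Set Ω := fun n => ⋃ j ∈ Finset.range ⌊δ / step n⌋₊,
    {ω | η / 2 * ((j + 1 : ℕ) * step n) ≤ |empMean X C n ω (deathInd ((j + 1 : ℕ) * step n)) -
      ∫ z, deathInd ((j + 1 : ℕ) * step n) z ∂pairLaw f g|} with hbad
  have hbadv : Vanishing P bad := by
    have hlim : Tendsto (fun n : ℕ => ENNReal.ofReal
        (4 * L * δ * (m + 1) ^ 2 / η ^ 4 / (n * r n ^ 2))) atTop (𝓝 0) := by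
      rw [← ENNReal.ofReal_zero]
      exact ENNReal.tendsto_ofReal (hnr.const_div_atTop _)
    refine tendsto_of_tendsto_of_tendsto_of_le_of_le' tendsto_const_nhds hlim
      (Eventually.of_forall fun _ => zero_le) ?_
    filter_upwards [hr, eventually_gt_atTop 0] with n hrn hn
    have hn' : (0 : ℝ) < n := Nat.cast_pos.mpr hn
    have hst : 0 < step n := by positivity
    have hterm : ∀ j ∈ Finset.range ⌊δ / step n⌋₊,
        P {ω | η / 2 * ((j + 1 : ℕ) * step n) ≤
          |empMean X C n ω (deathInd ((j + 1 : ℕ) * step n)) -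
            ∫ z, deathInd ((j + 1 : ℕ) * step n) z ∂pairLaw f g|} ≤
          ENNReal.ofReal (4 * L / (n * η ^ 2 * step n)) := by
      intro j hj
      set t := ((j + 1 : ℕ) : ℝ) * step n with ht
      have hj1 : (1 : ℝ) ≤ (j + 1 : ℕ) := by exact_mod_cast Nat.le_add_left 1 j
      have hstt : step n ≤ t := le_mul_of_one_le_left hst.le hj1
      have ht0 : 0 < t := hst.trans_le hstt
      have htδ : t ≤ δ := by
        have h1 : ((j + 1 : ℕ) : ℝ) ≤ ⌊δ / step n⌋₊ := by
          exact_mod_cast Finset.mem_range.mp hj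
        have h2 := h1.trans (Nat.floor_le (by positivity))
        rwa [le_div_iff₀ hst] at h2
      refine (hs.measure_abs_empMean_sub_ge (measurable_deathInd t) (abs_deathInd_le t) hn
        (by positivity)).trans (ENNReal.ofReal_le_ofReal ?_)
      calc (∫ z, deathInd t z ^ 2 ∂pairLaw f g) / (n * (η / 2 * t) ^ 2)
          ≤ L * t / (n * (η / 2 * t) ^ 2) := by gcongr; exact hup t ⟨ht0.le, htδ⟩
        _ = 4 * L / (n * η ^ 2 * t) := by field_simp; ring
        _ ≤ _ := by gcongr
    calc P (bad n) ≤ ∑ j ∈ Finset.range ⌊δ / step n⌋₊, _ := measure_biUnion_finset_le _ _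
      _ ≤ ∑ j ∈ Finset.range ⌊δ / step n⌋₊, ENNReal.ofReal (4 * L / (n * η ^ 2 * step n)) :=
          Finset.sum_le_sum hterm
      _ = ENNReal.ofReal (⌊δ / step n⌋₊ * (4 * L / (n * η ^ 2 * step n))) := by
          rw [Finset.sum_const, Finset.card_range, nsmul_eq_mul,
            ENNReal.ofReal_mul (Nat.cast_nonneg _), ENNReal.ofReal_natCast]
      _ ≤ ENNReal.ofReal (δ / step n * (4 * L / (n * η ^ 2 * step n))) := by
          gcongr
          exact Nat.floor_le (by positivity)
      _ = _ := by
          congr 1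
          rw [hstep]
          field_simp
  refine hbadv.mono ?_
  filter_upwards [hr] with n hrn
  rintro ω ⟨t, ht, hlt⟩
  by_contra hcon
  have hst : 0 < step n := by positivity
  have hms : m * step n ≤ η * r n := by
    rw [hstep]
    change m * (η * r n / (m + 1)) ≤ η * r n
    rw [mul_div_assoc', div_le_iff₀ hm1, mul_comm]
    gcongr
    linarith
  set j := ⌊t / step n⌋₊ with hj
  have hjt : j * step n ≤ t := by
    have := Nat.floor_le (show 0 ≤ t / step n from div_nonneg ht.1 hst.le)
    rwa [← hj, le_div_iff₀ hst] at this
  have htj : t - j * step n ≤ step n := by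
    have := Nat.lt_floor_add_one (t / step n)
    rw [← hj, div_lt_iff₀ hst] at this
    linarith
  have hgrid : (m - η) * (j * step n) ≤ nelsonAalen X C n ω t := by
    rcases Nat.eq_zero_or_pos j with h0 | h0
    · rw [h0, Nat.cast_zero, zero_mul, mul_zero]
      exact nelsonAalen_nonneg X C n ω t
    · obtain ⟨i, hi⟩ := Nat.exists_eq_succ_of_ne_zero h0.ne'
      have hmem : i ∈ Finset.range ⌊δ / step n⌋₊ := by
        rw [Finset.mem_range]
        have : j ≤ ⌊δ / step n⌋₊ := by
          apply Nat.floor_le_floor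
          gcongr
          exact ht.2
        omega
      have hnot : ¬ (η / 2 * (j * step n) ≤ |empMean X C n ω (deathInd (j * step n)) -
          ∫ z, deathInd (j * step n) z ∂pairLaw f g|) := by
        intro h
        rw [hi] at h
        exact hcon (mem_biUnion (show i ∈ (Finset.range ⌊δ / step n⌋₊ : Set ℕ) from hmem) h)
      have h1 := (abs_lt.mp (not_le.mp hnot)).1
      have h2 := hlow (j * step n) ⟨by positivity, hjt.trans ht.2⟩
      have h3 := empMean_deathInd_le_nelsonAalen (X := X) (C := C) (n := n) (ω := ω)
        (j * step n)
      have h4 := monotone_nelsonAalen X C n ω hjt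
      linarith
  have hrise : (m - η) * (t - j * step n) ≤ η * r n := by
    calc (m - η) * (t - j * step n) ≤ m * (t - j * step n) := by
          apply mul_le_mul_of_nonneg_right <;> linarith
      _ ≤ m * step n := by gcongr
      _ ≤ _ := hms
  linarith [show (m - η) * t = (m - η) * (j * step n) + (m - η) * (t - j * step n) by ring]

/-- Uniform consistency of the Nelson-Aalen estimator before the end of the supports. -/
theorem vanishing_nelsonAalen_uniform (hs : IsCensoredSample P X C f g) {M : ℝ} (hM : 0 ≤ M)
    (hF : cdf (densityLaw f) M < 1) (hG : cdf (densityLaw g) M < 1)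
    (hint : IntegrableOn (hazard f) (Icc 0 M)) {κ : ℝ} (hκ : 0 < κ) :
    Vanishing P fun n => {ω | ¬ ∀ t ∈ Icc 0 M,
      |nelsonAalen X C n ω t - ∫ s in (0 : ℝ)..t, hazard f s| ≤ κ} := by
  have hcont : ContinuousOn (fun t => ∫ s in (0 : ℝ)..t, hazard f s) (Icc 0 M) := by
    have := intervalIntegral.continuousOn_primitive_interval (μ := volume) (f := hazard f)
      (a := 0) (b := M) (by rwa [uIcc_of_le hM])
    rwa [uIcc_of_le hM] at this
  obtain ⟨Q, hQM, hQ⟩ := exists_finset_of_continuousOn hM hcont (half_pos hκ)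
  refine (Vanishing.biUnion (P := P) Q fun q hq => hs.vanishing_nelsonAalen (hQM q hq).1
    ((monotone_cdf _ (hQM q hq).2).trans_lt hF) ((monotone_cdf _ (hQM q hq).2).trans_lt hG)
    (half_pos hκ)).mono (Eventually.of_forall fun n ω hω => ?_)
  by_contra hcon
  refine hω fun t ht => ?_
  have := hQ (nelsonAalen X C n ω) ((monotone_nelsonAalen X C n ω).monotoneOn _)
    (fun q hq => ?_) t ht
  · linarith
  · by_contra h
    exact hcon (mem_biUnion (show q ∈ (Q : Set ℝ) from hq) (not_le.mp h).le)

end IsCensoredSample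

/-! ### The smoothed estimator -/

/-- A smoothed slope is close to the hazard if the slope is close to it beyond a boundary zone
`(0, r)`. -/
theorem abs_smoothed_minorantSlope_sub_le {k : ℝ → ℝ} (hk : IsStandardKernel k)
    {τ b x M' r B L η : ℝ} {lam A : ℝ → ℝ} (hb : 0 < b) (hx : 0 ≤ x) (hxM : x + b ≤ M')
    (hM' : M' < τ) (hr : 0 < r) (hrM : r ≤ M') (hη : 0 ≤ η) (hA : ∀ u ∈ Icc 0 τ, 0 ≤ A u)
    (hA0 : A 0 = 0) (hB : ∀ u, |boundaryKernel k τ b x u| ≤ B)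
    (hL : ∀ t ∈ Ico 0 τ, lam t ≤ L) (hlam : ∀ t ∈ Ico 0 τ, 0 ≤ lam t)
    (hosc : ∀ u ∈ Ico 0 τ, |u - x| ≤ b → |lam u - lam x| ≤ η)
    (hclose : ∀ u ∈ Icc r M', |minorantSlope τ A u - lam u| ≤ 3 * η) :
    |(∫ u in (max (x - b) 0)..(min (x + b) τ),
      (b⁻¹ * boundaryKernel k τ b x ((x - u) / b)) * minorantSlope τ A u) - lam x| ≤
      B * (8 * η + (L + 3 * η) * (r / b)) := by
  have hB0 : 0 ≤ B := (abs_nonneg _).trans (hB 0)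
  have hac : max (x - b) 0 ≤ x + b := max_le (by linarith) (by linarith)
  have ha : 0 ≤ max (x - b) 0 := le_max_right _ _
  have hsub : Ioc (max (x - b) 0) (x + b) ⊆ Ioo 0 τ :=
    fun u hu => ⟨ha.trans_lt hu.1, by linarith [hu.2]⟩
  have hxτ : x ∈ Ico 0 τ := ⟨hx, by linarith⟩
  have hlx := hL x hxτ
  have hlx0 := hlam x hxτ
  have hmono := monotoneOn_minorantSlope hA
  rw [min_eq_left (by linarith)]
  have h := abs_integral_mul_sub_le (S := minorantSlope τ A) (l := lam x) (β := b⁻¹ * B)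
    (η := 4 * η) (D := L + 3 * η) (r := r) ha hac
    (hk.integrable_scaled_boundaryKernel τ x hb).intervalIntegrable
    (hk.integral_boundaryKernel hb hx (by linarith))
    (fun u => by
      rw [abs_mul, abs_of_pos (inv_pos.mpr hb)]
      gcongr
      exact hB _)
    (aemeasurable_restrict_of_monotoneOn measurableSet_Ioc (hmono.mono hsub)).aestronglyMeasurable
    (by positivity) (by linarith) hr.le
    (fun u hu hru => by
      have h1 := hclose u ⟨hru, hu.2.trans hxM⟩
      have h2 := hosc u ⟨(hsub hu).1.le, (hsub hu).2⟩ (by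
        rw [abs_le]
        constructor <;> linarith [hu.1, hu.2, le_max_left (x - b) 0])
      linarith [abs_sub_le (minorantSlope τ A u) (lam u) (lam x)])
    (fun u hu hur => by
      have h1 := minorantSlope_nonneg hA hA0 (hsub hu).1 (hsub hu).2
      have h2 := hmono (hsub hu) ⟨hr, by linarith⟩ hur.le
      have h3 := (abs_le.mp (hclose r ⟨le_rfl, hrM⟩)).2
      have h4 := hL r ⟨hr.le, by linarith⟩
      rw [abs_le]
      constructor <;> linarith)
  refine h.trans ?_
  have h5 : x + b - max (x - b) 0 ≤ 2 * b := by linarith [le_max_left (x - b) 0]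
  have h6 : (0 : ℝ) ≤ 4 * η := by positivity
  calc b⁻¹ * B * ((x + b - max (x - b) 0) * (4 * η) + (L + 3 * η) * r)
      ≤ b⁻¹ * B * (2 * b * (4 * η) + (L + 3 * η) * r) := by gcongr
    _ = B * (8 * η + (L + 3 * η) * (r / b)) := by field_simp; ring

/-! ### Bandwidths -/

section Bandwidth

variable {b : ℕ → ℝ} {α c : ℝ}

theorem eventually_bandwidth_pos (hc : 0 < c)
    (hb : Tendsto (fun n : ℕ => b n * (n : ℝ) ^ α) atTop (𝓝 c)) : ∀ᶠ n in atTop, 0 < b n := by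
  filter_upwards [hb.eventually_const_lt hc, eventually_gt_atTop 0] with n h hn
  exact pos_of_mul_pos_left h (Real.rpow_nonneg (Nat.cast_nonneg n) α)

theorem tendsto_bandwidth (hα : 0 < α)
    (hb : Tendsto (fun n : ℕ => b n * (n : ℝ) ^ α) atTop (𝓝 c)) : Tendsto b atTop (𝓝 0) := by
  have h1 : Tendsto (fun n : ℕ => (n : ℝ) ^ (-α)) atTop (𝓝 0) :=
    (tendsto_rpow_neg_atTop hα).comp tendsto_natCast_atTop_atTop
  have h2 := hb.mul h1
  rw [mul_zero] at h2
  refine h2.congr' ?_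
  filter_upwards [eventually_gt_atTop 0] with n hn
  have hn' : (0 : ℝ) < n := Nat.cast_pos.mpr hn
  rw [mul_assoc, ← Real.rpow_add hn', add_neg_cancel, Real.rpow_zero, mul_one]

/-- Bandwidths of larger order than `n ^ (-1/2)`: this is where `α < 1/2` enters. -/
theorem tendsto_mul_sq_bandwidth (hα : α < 1 / 2) (hc : 0 < c)
    (hb : Tendsto (fun n : ℕ => b n * (n : ℝ) ^ α) atTop (𝓝 c)) {ρ : ℝ} (hρ : 0 < ρ) :
    Tendsto (fun n : ℕ => n * (ρ * b n) ^ 2) atTop atTop := by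
  have h1 : Tendsto (fun n : ℕ => (n : ℝ) ^ (1 - 2 * α)) atTop atTop :=
    (tendsto_rpow_atTop (by linarith)).comp tendsto_natCast_atTop_atTop
  have h2 := ((hb.pow 2).const_mul (ρ ^ 2)).pos_mul_atTop (by positivity) h1
  refine h2.congr' ?_
  filter_upwards [eventually_gt_atTop 0] with n hn
  have hn' : (0 : ℝ) < n := Nat.cast_pos.mpr hn
  rw [Real.rpow_sub hn', Real.rpow_one, mul_comm 2 α, Real.rpow_mul hn'.le, Real.rpow_two]
  have : (n : ℝ) ^ α ≠ 0 := (Real.rpow_pos_of_pos hn' α).ne'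
  field_simp

end Bandwidth

end SmoothedGrenander

end

theorem mainTheorem4 {Ω : Type*} [MeasurableSpace Ω] (P : Measure Ω) [IsProbabilityMeasure P]
    (X C : ℕ → Ω → ℝ) (f g : ℝ → ℝ)
    (hsample : SmoothedGrenander.IsCensoredSample P X C f g)
    (τ : ℝ)
    (hτH : SmoothedGrenander.upperEndpoint
      (P.map (SmoothedGrenander.followUp X C 0)) = (τ : EReal))
    (hτG : SmoothedGrenander.upperEndpoint (SmoothedGrenander.densityLaw g) = (τ : EReal))
    (hτF : (τ : EReal) < SmoothedGrenander.upperEndpoint (SmoothedGrenander.densityLaw f))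
    (hmono : MonotoneOn (SmoothedGrenander.hazard f) (Ico 0 τ))
    (hunif : UniformContinuousOn (SmoothedGrenander.hazard f) (Ico 0 τ))
    (k : ℝ → ℝ) (hk : SmoothedGrenander.IsStandardKernel k)
    (hkdiff : DifferentiableOn ℝ k (Ioo (-1) 1))
    (hkbdd : ∃ K : ℝ, ∀ u ∈ Ioo (-1 : ℝ) 1, |deriv k u| ≤ K)
    (b : ℕ → ℝ) (α c : ℝ) (hα : 0 < α) (hα' : α < 1 / 2) (hc : 0 < c)
    (hb : Tendsto (fun n : ℕ => b n * (n : ℝ) ^ α) atTop (𝓝 c))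
    (M : ℝ) (hM : 0 < M) (hMτ : M < τ) :
    ∀ ε : ℝ, 0 < ε →
      Tendsto (fun n : ℕ => P {ω | ENNReal.ofReal ε ≤
        ⨆ x ∈ Icc (0 : ℝ) M, ENNReal.ofReal
          |SmoothedGrenander.smoothedGrenander X C k τ (b n) n ω x
            - SmoothedGrenander.hazard f x|})
        atTop (𝓝 0) := by
  open SmoothedGrenander in
  intro ε hε
  have hτ : 0 < τ := hM.trans hMτ
  have hG : ∀ t < τ, cdf (densityLaw g) t < 1 := fun t ht =>
    cdf_lt_one_of_lt_upperEndpoint (hτG ▸ EReal.coe_lt_coe_iff.mpr ht)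
  have hF : ∀ t < τ, cdf (densityLaw f) t < 1 := fun t ht =>
    cdf_lt_one_of_lt_upperEndpoint ((EReal.coe_lt_coe_iff.mpr ht).trans hτF)
  obtain ⟨L, hL0, hL⟩ := exists_bound_of_monotoneOn_uniformContinuousOn hτ hmono hunif
  obtain ⟨B, hB0, hB⟩ := hk.exists_boundaryKernel_bound hkdiff hkbdd
  have hprim := isMonotonePrimitive_integral hmono fun t _ => hsample.hazard_nonneg t
  set M' := (M + τ) / 2 with hM'def
  have hMM' : M < M' := by linarith
  have hM'τ : M' < τ := by linarith
  have hM'0 : 0 < M' := hM.trans hMM'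
  -- The final bound `B * (8 * η + (L + 3 * η) * ρ)` is to be at most `ε / 2`.
  set η := min 1 (ε / (32 * B)) with hηdef
  have hη : 0 < η := lt_min one_pos (by positivity)
  have hη1 : η ≤ 1 := min_le_left _ _
  set ρ := min 1 (ε / (4 * B * (L + 3))) with hρdef
  have hρ : 0 < ρ := lt_min one_pos (by positivity)
  have hρ1 : ρ ≤ 1 := min_le_left _ _
  have hfinal : B * (8 * η + (L + 3 * η) * ρ) ≤ ε / 2 := by
    have h1 : B * (8 * η) ≤ ε / 4 := by
      have : η ≤ ε / (32 * B) := min_le_right _ _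
      rw [le_div_iff₀ (by positivity)] at this
      linarith
    have h2 : B * ((L + 3) * ρ) ≤ ε / 4 := by
      have : ρ ≤ ε / (4 * B * (L + 3)) := min_le_right _ _
      rw [le_div_iff₀ (by positivity)] at this
      linarith
    have h3 : B * ((L + 3 * η) * ρ) ≤ B * ((L + 3) * ρ) := by
      gcongr
      linarith
    linarith
  obtain ⟨δ₀, hδ₀, hnear⟩ :=
    hsample.exists_vanishing_nelsonAalen_lt hτ hF hG hmono hL0 hL hη
  obtain ⟨δ, M₂, κ, hδ, hδδ₀, hM'M₂, hM₂τ, hκ, hslope⟩ :=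
    hprim.exists_forall_abs_minorantSlope_sub_le hunif hL0 hL hM'0 hM'τ hη hδ₀
  have hM₂0 : 0 ≤ M₂ := by linarith
  have hbpos := eventually_bandwidth_pos hc hb
  have hb0 := tendsto_bandwidth hα hb
  have hv1 := Vanishing.of_null (P := P) (ae_iff.mp hsample.ae_followUp_pos)
  have hv2 := hsample.vanishing_nelsonAalen_uniform hM₂0 (hF _ hM₂τ) (hG _ hM₂τ)
    ((hmono.mono fun t ht => ⟨ht.1, ht.2.trans_lt hM₂τ⟩).integrableOn_isCompact isCompact_Icc) hκ
  have hv3 := hnear δ hδ hδδ₀ (fun n => ρ * b n) (hbpos.mono fun n hn => mul_pos hρ hn)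
    (tendsto_mul_sq_bandwidth hα' hc hb hρ)
  obtain ⟨d, hd, hosc⟩ := Metric.uniformContinuousOn_iff.mp hunif η hη
  refine ((hv1.union hv2).union hv3).mono ?_
  filter_upwards [hbpos, hb0.eventually_lt_const (sub_pos.mpr hMM'), hb0.eventually_lt_const hd]
    with n hbn hbM hbd ω hω
  by_contra hcon
  simp only [mem_union, not_or] at hcon
  obtain ⟨⟨h1, h2⟩, h3⟩ := hcon
  have h1 : ∀ i, 0 < followUp X C i ω := not_not.mp h1
  have h2 := not_not.mp h2
  have h3 : ∀ t ∈ Icc 0 δ, (hazard f 0 - η) * t - η * (ρ * b n) ≤ nelsonAalen X C n ω t :=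
    fun t ht => not_lt.mp fun h => h3 ⟨t, ht, h⟩
  have hr : 0 < ρ * b n := mul_pos hρ hbn
  have hrb : ρ * b n ≤ b n := mul_le_of_le_one_left hbn.le hρ1
  have hA : ∀ u ∈ Icc 0 τ, 0 ≤ nelsonAalen X C n ω u := fun u _ => nelsonAalen_nonneg X C n ω u
  have hA0 : nelsonAalen X C n ω 0 = 0 := nelsonAalen_zero h1
  have hclose := hslope _ (monotone_nelsonAalen X C n ω) hA hA0 h2 _ hr h3
  have hsup : ⨆ x ∈ Icc (0 : ℝ) M, ENNReal.ofReal
      |smoothedGrenander X C k τ (b n) n ω x - hazard f x| ≤ ENNReal.ofReal (ε / 2) := by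
    refine iSup₂_le fun x hx => ENNReal.ofReal_le_ofReal ?_
    have h := abs_smoothed_minorantSlope_sub_le hk hbn hx.1 (by linarith [hx.2]) hM'τ hr
      (by linarith) hη.le hA hA0 (fun u => hB τ (b n) x u hbn hx.1 (by linarith [hx.2])) hL
      (fun t _ => hsample.hazard_nonneg t)
      (fun u hu hux => (hosc u hu x ⟨hx.1, by linarith [hx.2]⟩
        (by rw [Real.dist_eq]; linarith)).le) hclose
    rw [mul_div_cancel_right₀ _ hbn.ne'] at h
    exact h.trans hfinal
  exact absurd ((hω : ENNReal.ofReal ε ≤ _).trans hsup)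
    (not_le.mpr ((ENNReal.ofReal_lt_ofReal_iff hε).mpr (half_lt_self hε)))
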